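/- Let $X$ be an irreducible, locally finite ${\rm CAT(0)}$ cube complex (possibly infinite dimensional), endowed with its combinatorial ($\ell^1$) path metric $d$. For a cubical automorphism $f\in\mathrm{Aut}(X)$ let $\ell_X(f)=\inf_{p\in X}d(p,fp)$. Let $\overline X$ be the Roller compactification of $X$, i.e. the space of ultrafilters of halfspaces of $X$ with the topology of pointwise convergence; for a vertex $v$ and $x,y\in\overline X$ let $(x\cdot y)_v\in\mathbb N\cup\{+\infty\}$ be the number of hyperplanes separating $v$ from $\{x,y\}$. Let $\mathscr A\subseteq\overline X^4$ be the set of $(x,y,z,w)$ for which at most one of $(x\cdot y)_v+(z\cdot w)_v$, $(x\cdot z)_v+(y\cdot w)_v$, $(x\cdot w)_v+(y\cdot z)_v$ is infinite, and for $(x,y,z,w)\in\mathscr A$ put $$\mathrm{cr}(x,y,z,w)=(x\cdot z)_v+(y\cdot w)_v-(x\cdot w)_v-(y\cdot z)_v\in\mathbb Z\cup\{\pm\infty\}$$ (these notions do not depend on $v$). Two disjoint halfspaces are strongly separated if no hyperplane is transverse to both of their bounding hyperplanes; a point of $\overline X\setminus X$ is regular if its ultrafilter contains an infinite chain of halfspaces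 $\mathfrak h_0\supsetneq\mathfrak h_1\supsetneq\cdots$ with $\mathfrak h_n^*$ and $\mathfrak h_{n+1}$ strongly separated for all $n$, where $^*$ denotes the complement. An automorphism $g$ is neatly contracting if there are halfspaces $\mathfrak h_1,\mathfrak h_2$ with $g\mathfrak h_1\subseteq\mathfrak h_2\subseteq\mathfrak h_1$ and $g\mathfrak h_1\ne\mathfrak h_1$ such that both pairs $(\mathfrak h_2,\mathfrak h_1^*)$ and $(g\mathfrak h_1,\mathfrak h_2^*)$ are strongly separated. For such $g$ there is a unique pair $(g^-,g^+)$ of distinct points of $\overline X$ such that $g^-$ and $g^+$ are exactly the regular points fixed by $g$, and $g^nx\to g^+$, $g^{-n}x\to g^-$ as $n\to+\infty$ for every $x\in\overline X\setminus\{g^-,g^+\}$. Theorem. Let $g,h\in\mathrm{Aut}(X)$ be neatly contracting automorphisms whose pairs of points $g^\pm$, $h^\pm$ satisfy $\#\{g^-,g^+,h^-,h^+\}=4$. Then $(g^-,h^-,g^+,h^+)\in\mathscr A$, and there exists $N\ge 0$ such that for every $n\ge N$ $$2\,\mathrm{cr}(g^-,h^-,g^+,h^+)=\ell_X(g^nh^n)-\ell_X(g^n)-\ell_X(h^n).$$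 -/

import Mathlib

open Filter Topology

universe u

/-- `φ` is a parametrisation of a cube of the family `cubes` (each cube being given by its vertex
set) by the vertices of the standard cube `[0,1]ⁿ`: it is injective, and the members of `cubes`
contained in its image are exactly the images of the faces of `[0,1]ⁿ` (in particular its image,
the image of the improper face, is a member). -/
def IsCubeChart {V : Type u} (cubes : Set (Set V)) {n : ℕ} (φ : (Fin n → Bool) → V) : Prop :=
  Function.Injective φ ∧
    ∀ d : Set V, d ⊆ Set.range φ →
      (d ∈ cubes ↔ ∃ (S : Set (Fin n)) (a : Fin n → Bool), d = φ '' {x | ∀ i ∈ S, x i = a i})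

/-- A cubical complex with vertex set `V`, of arbitrary, possibly infinite, dimension: unit cubes
`[0,1]ⁿ` (`n` finite) are glued along faces, each cube is embedded, and two cubes are disjoint or
meet in a common face. Such a complex is recorded by the vertex sets of its cubes. -/
structure CubeComplex (V : Type u) where
  cubes : Set (Set V)
  singleton_mem : ∀ v : V, {v} ∈ cubes
  exists_chart : ∀ c ∈ cubes, ∃ (n : ℕ) (φ : (Fin n → Bool) → V),
    IsCubeChart cubes φ ∧ Set.range φ = c
  inter_mem : ∀ c ∈ cubes, ∀ d ∈ cubes, (c ∩ d).Nonempty → c ∩ d ∈ cubes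

namespace CubeComplex

variable {V : Type u} (X : CubeComplex V)

/-- The 1-skeleton. -/
def skeleton : SimpleGraph V where
  Adj v w := v ≠ w ∧ ({v, w} : Set V) ∈ X.cubes
  symm := ⟨fun v w h => ⟨h.1.symm, by rw [Set.pair_comm]; exact h.2⟩⟩
  loopless := ⟨fun _ h => h.1 rfl⟩

/-- `a, b, c, d` are the vertices of a square of `X`, in cyclic order. -/
structure IsSquare (a b c d : V) : Prop where
  ab : X.skeleton.Adj a b
  bc : X.skeleton.Adj b c
  cd : X.skeleton.Adj c d
  da : X.skeleton.Adj d a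
  ac : a ≠ c
  bd : b ≠ d
  mem : ({a, b, c, d} : Set V) ∈ X.cubes

/-! ### Simple connectedness and the link condition -/

/-- Homotopy of edge paths relative to the endpoints: the equivalence relation generated by
removing backtracks and by pushing a path across a square. -/
inductive Homotopic : ∀ {u v : V}, X.skeleton.Walk u v → X.skeleton.Walk u v → Prop
  | refl {u v : V} (p : X.skeleton.Walk u v) : Homotopic p p
  | symm {u v : V} {p q : X.skeleton.Walk u v} : Homotopic p q → Homotopic q p
  | trans {u v : V} {p q r : X.skeleton.Walk u v} :
      Homotopic p q → Homotopic q r → Homotopic p r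
  | backtrack {u v w z : V} (p : X.skeleton.Walk u v) (e : X.skeleton.Adj v w)
      (q : X.skeleton.Walk v z) :
      Homotopic (p.append (.cons e (.cons e.symm q))) (p.append q)
  | square {u a b c d z : V} (p : X.skeleton.Walk u a) (s : X.IsSquare a b c d)
      (q : X.skeleton.Walk c z) :
      Homotopic (p.append (.cons s.ab (.cons s.bc q)))
        (p.append (.cons s.da.symm (.cons s.cd.symm q)))

/-- `X` is connected (and nonempty) and its edge-path group is trivial. -/
def SimplyConnected : Prop :=
  X.skeleton.Connected ∧
    ∀ (u : V) (p : X.skeleton.Walk u u), X.Homotopic p SimpleGraph.Walk.nil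

/-- All links of vertices are flag complexes: finitely many edges at `v`, any two of which lie in a
common cube, all lie in a common cube. -/
def FlagLinks : Prop :=
  ∀ (v : V) (S : Finset V), (∀ a ∈ S, X.skeleton.Adj v a) →
    (∀ a ∈ S, ∀ b ∈ S, a ≠ b → ∃ c ∈ X.cubes, v ∈ c ∧ a ∈ c ∧ b ∈ c) →
    ∃ c ∈ X.cubes, v ∈ c ∧ ∀ a ∈ S, a ∈ c

/-- CAT(0) cube complexes. -/
structure IsCAT0 : Prop where
  simplyConnected : X.SimplyConnected
  flagLinks : X.FlagLinks

/-- `X` does not split as a product of two cube complexes, both different from a point. -/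
def Irreducible : Prop :=
  ∀ (Y Z : Type u) (CY : CubeComplex Y) (CZ : CubeComplex Z) (e : V ≃ Y × Z),
    (∀ c : Set V, c ∈ X.cubes ↔ ∃ a ∈ CY.cubes, ∃ b ∈ CZ.cubes, e '' c = a ×ˢ b) →
    Subsingleton Y ∨ Subsingleton Z

/-- Every vertex has finitely many neighbours. -/
def LocallyFinite : Prop := ∀ v : V, {w | X.skeleton.Adj v w}.Finite

/-- The group of cubical automorphisms. -/
def Aut : Subgroup (Equiv.Perm V) where
  carrier := {g | ∀ c : Set V, c ∈ X.cubes ↔ g '' c ∈ X.cubes}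
  one_mem' := fun c => by simp
  mul_mem' := by
    intro g h hg hh c
    rw [hh c, hg (h '' c), Set.image_image]
    rfl
  inv_mem' := by
    intro g hg c
    rw [hg ((g⁻¹ : Equiv.Perm V) '' c), Set.image_image]
    simp

/-! ### The combinatorial metric and translation lengths -/

/-- The point of a parametrised cube with coordinates `t`, written as a convex combination of the
vertices of the cube, with multilinear weights. This identifies the points of the geometric
realisation of `X` with functions on the vertex set (a vertex corresponds to its indicator). -/
noncomputable def cubePoint {n : ℕ} (φ : (Fin n → Bool) → V) (t : Fin n → unitInterval) : V → ℝ :=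
  open Classical in
  fun v => ∑ x : Fin n → Bool,
    if φ x = v then ∏ i, (if x i then (t i : ℝ) else 1 - (t i : ℝ)) else 0

/-- The set of all points (not just vertices) of `X`. -/
def realization : Set (V → ℝ) :=
  {p | ∃ (n : ℕ) (φ : (Fin n → Bool) → V) (t : Fin n → unitInterval),
    IsCubeChart X.cubes φ ∧ p = cubePoint φ t}

/-- `X.StringLength p q r`: there is a finite string of points from `p` to `q`, any two consecutive
ones lying in a common cube, the `ℓ¹` lengths of whose steps add up to `r`. -/
inductive StringLength : (V → ℝ) → (V → ℝ) → ℝ → Prop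
  | nil (p : V → ℝ) (hp : p ∈ X.realization) : StringLength p p 0
  | cons {n : ℕ} (φ : (Fin n → Bool) → V) (hφ : IsCubeChart X.cubes φ)
      (s t : Fin n → unitInterval) {q : V → ℝ} {r : ℝ} :
      StringLength (cubePoint φ t) q r →
      StringLength (cubePoint φ s) q ((∑ i, |(s i : ℝ) - (t i : ℝ)|) + r)

/-- The combinatorial metric on the points of `X`: the path metric induced by the `ℓ¹` metrics
of the cubes. -/
noncomputable def l1Dist (p q : V → ℝ) : ℝ := sInf {r | X.StringLength p q r}

/-- The translation length `inf d(p, g p)`, over all points `p` of `X`; the point `g p` is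
`p ∘ g⁻¹`. -/
noncomputable def translationLength (g : X.Aut) : ℝ :=
  sInf {r | ∃ p ∈ X.realization, r = X.l1Dist p (fun v => p ((g : Equiv.Perm V)⁻¹ v))}

/-! ### Hyperplanes and halfspaces -/

/-- `e` and `f` are opposite edges of a square. -/
def Opposite (e f : Sym2 V) : Prop := ∃ a b c d : V, X.IsSquare a b c d ∧ e = s(a, b) ∧ f = s(d, c)

/-- The hyperplane dual to the edge `e`, as the set of all edges crossing it. -/
def hyperplane (e : Sym2 V) : Set (Sym2 V) := {f | Relation.EqvGen X.Opposite e f}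

/-- `h` is a side of the hyperplane dual to `e`: a connected component of the complement. -/
def IsSide (e : Sym2 V) (h : Set V) : Prop :=
  ∃ v : V, h = {w | (X.skeleton.deleteEdges (X.hyperplane e)).Reachable v w}

/-- Halfspaces, as sets of vertices. -/
def IsHalfspace (h : Set V) : Prop := ∃ e ∈ X.skeleton.edgeSet, X.IsSide e h

/-- The halfspaces `h` and `k` are bounded by transverse hyperplanes. -/
def Transverse (h k : Set V) : Prop :=
  (h ∩ k).Nonempty ∧ (hᶜ ∩ k).Nonempty ∧ (h ∩ kᶜ).Nonempty ∧ (hᶜ ∩ kᶜ).Nonempty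

/-- Disjoint halfspaces such that no hyperplane is transverse to both. -/
def StronglySeparated (h k : Set V) : Prop :=
  X.IsHalfspace h ∧ X.IsHalfspace k ∧ Disjoint h k ∧
    ¬ ∃ j, X.IsHalfspace j ∧ Transverse j h ∧ Transverse j k

/-- Neatly contracting automorphisms. The condition `g h₁ ≠ h₁` only excludes the degenerate case
`g h₁ = h₂ = h₁`. -/
def NeatlyContracting (g : X.Aut) : Prop :=
  ∃ h₁ h₂ : Set V, X.IsHalfspace h₁ ∧ X.IsHalfspace h₂ ∧
    (g : Equiv.Perm V) '' h₁ ⊆ h₂ ∧ h₂ ⊆ h₁ ∧ (g : Equiv.Perm V) '' h₁ ≠ h₁ ∧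
    X.StronglySeparated h₂ h₁ᶜ ∧ X.StronglySeparated ((g : Equiv.Perm V) '' h₁) h₂ᶜ

/-! ### Automorphisms act on halfspaces -/

theorem adj_map (g : X.Aut) {v w : V} (h : X.skeleton.Adj v w) :
    X.skeleton.Adj ((g : Equiv.Perm V) v) ((g : Equiv.Perm V) w) := by
  refine ⟨fun e => h.1 ((g : Equiv.Perm V).injective e), ?_⟩
  have := (g.2 {v, w}).1 h.2
  rwa [Set.image_pair] at this

theorem isSquare_map (g : X.Aut) {a b c d : V} (h : X.IsSquare a b c d) :
    X.IsSquare ((g : Equiv.Perm V) a) ((g : Equiv.Perm V) b) ((g : Equiv.Perm V) c)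
      ((g : Equiv.Perm V) d) where
  ab := X.adj_map g h.ab
  bc := X.adj_map g h.bc
  cd := X.adj_map g h.cd
  da := X.adj_map g h.da
  ac := fun e => h.ac ((g : Equiv.Perm V).injective e)
  bd := fun e => h.bd ((g : Equiv.Perm V).injective e)
  mem := by
    have := (g.2 {a, b, c, d}).1 h.mem
    simpa [Set.image_insert_eq] using this

theorem hyperplane_map (g : X.Aut) {e f : Sym2 V} (h : f ∈ X.hyperplane e) :
    f.map (g : Equiv.Perm V) ∈ X.hyperplane (e.map (g : Equiv.Perm V)) := by
  change Relation.EqvGen X.Opposite e f at h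
  change Relation.EqvGen X.Opposite _ _
  induction h with
  | rel x y h =>
    obtain ⟨a, b, c, d, h, rfl, rfl⟩ := h
    exact .rel _ _ ⟨_, _, _, _, X.isSquare_map g h, rfl, rfl⟩
  | refl x => exact .refl _
  | symm x y _ ih => exact .symm _ _ ih
  | trans x y z _ _ ih₁ ih₂ => exact .trans _ _ _ ih₁ ih₂

theorem sym2_map_inv (g : X.Aut) (e : Sym2 V) :
    (e.map (g : Equiv.Perm V)).map ((g⁻¹ : X.Aut) : Equiv.Perm V) = e := by
  induction e with
  | _ a b => simp

theorem reachable_map (g : X.Aut) {e : Sym2 V} {v w : V}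
    (h : (X.skeleton.deleteEdges (X.hyperplane e)).Reachable v w) :
    (X.skeleton.deleteEdges (X.hyperplane (e.map (g : Equiv.Perm V)))).Reachable
      ((g : Equiv.Perm V) v) ((g : Equiv.Perm V) w) := by
  refine h.map (⟨(g : Equiv.Perm V), ?_⟩ : X.skeleton.deleteEdges (X.hyperplane e) →g
    X.skeleton.deleteEdges (X.hyperplane (e.map (g : Equiv.Perm V))))
  intro a b hab
  rw [SimpleGraph.deleteEdges_adj] at hab ⊢
  refine ⟨X.adj_map g hab.1, fun hm => hab.2 ?_⟩
  have := X.hyperplane_map g⁻¹ hm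
  rw [X.sym2_map_inv g e] at this
  simpa using this

theorem isSide_map (g : X.Aut) {e : Sym2 V} {h : Set V} (hh : X.IsSide e h) :
    X.IsSide (e.map (g : Equiv.Perm V)) ((g : Equiv.Perm V) '' h) := by
  obtain ⟨v, rfl⟩ := hh
  refine ⟨(g : Equiv.Perm V) v, ?_⟩
  ext w
  constructor
  · rintro ⟨w, hw, rfl⟩
    exact X.reachable_map g hw
  · intro hw
    have := X.reachable_map g⁻¹ hw
    rw [X.sym2_map_inv g e] at this
    exact ⟨(g : Equiv.Perm V)⁻¹ w, by simpa using this, by simp⟩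

theorem edge_map (g : X.Aut) {e : Sym2 V} (he : e ∈ X.skeleton.edgeSet) :
    e.map (g : Equiv.Perm V) ∈ X.skeleton.edgeSet := by
  induction e with
  | _ a b => exact X.adj_map g he

theorem isHalfspace_map (g : X.Aut) {h : Set V} (hh : X.IsHalfspace h) :
    X.IsHalfspace ((g : Equiv.Perm V) '' h) := by
  obtain ⟨e, he, hs⟩ := hh
  exact ⟨_, X.edge_map g he, X.isSide_map g hs⟩

/-! ### The Roller compactification -/

/-- A point of the Roller compactification: an ultrafilter of halfspaces, i.e. a set of pairwise
intersecting halfspaces that contains a side of each hyperplane. -/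
@[ext]
structure Roller where
  sides : Set (Set V)
  isHalfspace : ∀ h ∈ sides, X.IsHalfspace h
  inter_nonempty : ∀ h ∈ sides, ∀ k ∈ sides, (h ∩ k).Nonempty
  exists_side : ∀ e ∈ X.skeleton.edgeSet, ∃ h ∈ sides, X.IsSide e h

/-- The topology of pointwise convergence on sets of halfspaces, i.e. the subspace topology from
the product of discrete two-point spaces. -/
instance : TopologicalSpace X.Roller :=
  TopologicalSpace.induced (fun x (h : Set V) => h ∈ x.sides)
    (@Pi.topologicalSpace (Set V) (fun _ => Prop) (fun _ => ⊥))

/-- The vertex `v` as a point of the Roller compactification. -/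
def vertexPoint (v : V) : X.Roller where
  sides := {h | X.IsHalfspace h ∧ v ∈ h}
  isHalfspace := fun _ h => h.1
  inter_nonempty := fun _ hh _ hk => ⟨v, hh.2, hk.2⟩
  exists_side := fun e he =>
    ⟨{w | (X.skeleton.deleteEdges (X.hyperplane e)).Reachable v w},
      ⟨⟨e, he, v, rfl⟩, SimpleGraph.Reachable.refl v⟩, v, rfl⟩

/-- The action of an automorphism on the Roller compactification. -/
def rollerMap (g : X.Aut) (x : X.Roller) : X.Roller where
  sides := (fun h => (g : Equiv.Perm V) '' h) '' x.sides
  isHalfspace := by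
    rintro _ ⟨h, hh, rfl⟩
    exact X.isHalfspace_map g (x.isHalfspace h hh)
  inter_nonempty := by
    rintro _ ⟨h, hh, rfl⟩ _ ⟨k, hk, rfl⟩
    obtain ⟨v, hv⟩ := x.inter_nonempty h hh k hk
    exact ⟨(g : Equiv.Perm V) v, ⟨v, hv.1, rfl⟩, ⟨v, hv.2, rfl⟩⟩
  exists_side := by
    intro e he
    obtain ⟨h, hh, hs⟩ := x.exists_side _ (X.edge_map g⁻¹ he)
    refine ⟨_, ⟨h, hh, rfl⟩, ?_⟩
    have h₁ := X.isSide_map g hs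
    have h₂ := X.sym2_map_inv g⁻¹ e
    rw [inv_inv] at h₂
    rwa [h₂] at h₁

/-- The regular boundary: points of the Roller boundary (that is, not vertices) whose ultrafilter
contains an infinite strongly separated chain. -/
def regularBoundary : Set X.Roller :=
  {x | (∀ v : V, x ≠ X.vertexPoint v) ∧
    ∃ h : ℕ → Set V, ∀ n : ℕ, h n ∈ x.sides ∧ h (n + 1) ⊂ h n ∧
      X.StronglySeparated (h n)ᶜ (h (n + 1))}

/-- `m` and `p` are the points `g⁻` and `g⁺`: the two points of the regular boundary fixed by `g`,
the first one repelling and the second one attracting. -/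
structure IsPolePair (g : X.Aut) (m p : X.Roller) : Prop where
  ne : m ≠ p
  fixed : {x | x ∈ X.regularBoundary ∧ X.rollerMap g x = x} = {m, p}
  attracting : ∀ x : X.Roller, x ≠ m → x ≠ p →
    Tendsto (fun n : ℕ => X.rollerMap (g ^ n) x) atTop (𝓝 p)
  repelling : ∀ x : X.Roller, x ≠ m → x ≠ p →
    Tendsto (fun n : ℕ => X.rollerMap (g⁻¹ ^ n) x) atTop (𝓝 m)

/-! ### The cross ratio -/

/-- The Gromov product `(x · y)_v`: the number of hyperplanes separating `v` from `x` and `y`. Each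
of them is counted through its side containing `x` and `y` but not `v`. -/
noncomputable def gromovProduct (v : V) (x y : X.Roller) : ℕ∞ :=
  {h : Set V | h ∈ x.sides ∧ h ∈ y.sides ∧ v ∉ h}.encard

/-- The domain of the cross ratio based at `v`: at most one of the three quantities
`(x · y)_v + (z · w)_v`, `(x · z)_v + (y · w)_v`, `(x · w)_v + (y · z)_v` is infinite. -/
def InCrossRatioDomain (v : V) (x y z w : X.Roller) : Prop :=
  let a := X.gromovProduct v x y + X.gromovProduct v z w
  let b := X.gromovProduct v x z + X.gromovProduct v y w
  let c := X.gromovProduct v x w + X.gromovProduct v y z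
  (a ≠ ⊤ ∧ b ≠ ⊤) ∨ (a ≠ ⊤ ∧ c ≠ ⊤) ∨ (b ≠ ⊤ ∧ c ≠ ⊤)

/-- The cross ratio based at `v`, with values in `ℤ ∪ {±∞}`; meaningful on its domain, where it is
never of the form `∞ - ∞`. -/
noncomputable def crossRatio (v : V) (x y z w : X.Roller) : EReal :=
  (((X.gromovProduct v x z + X.gromovProduct v y w : ℕ∞) : ENNReal) : EReal) -
    (((X.gromovProduct v x w + X.gromovProduct v y z : ℕ∞) : ENNReal) : EReal)

end CubeComplex

/-!
The proof has three layers: the 1-skeleton of a CAT(0) cube complex is a graph whose metric counts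
halfspaces; strongly separated halfspaces control the dynamics of a neatly contracting automorphism;
and both sides of the formula are computed by counting halfspaces.

*From the cube complex to its halfspaces.* Edge paths are considered up to exchanging two sides of
a square for the two opposite ones (`Shuffle`). The flag condition shows that two equivalent paths
with different first edges can be shuffled to start along the two sides of one square
(`Shuffle.first_step`). Hence prolonging a path by an edge and cancelling a backtrack is well
defined up to shuffling, and depends only on the homotopy class of the walk used for the
prolongation (`act_homotopic`). Simple connectedness then makes reduced paths with given endpoints
unique up to shuffling (`ReducedFrom.shuffle`), so they are geodesics, the 1-skeleton is bipartite
(`dist_adj`) and it satisfies the quadrangle condition (`quadrangle`). The quadrangle condition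
shows that the sides of the hyperplane of an edge `uv` are the sets of vertices closer to `u`,
respectively to `v` (`isSide_iff`), and the distance of two vertices is the number of halfspaces
containing the first but not the second (`ncard_sep`).

*Dynamics.* If `g` is neatly contracting, the halfspaces `a m = gᵐ 𝔥₁` form a chain in which no
halfspace cuts both `a (m + 1)` and the complement of `a m` (`Axis`). So every halfspace or its
complement contains some `a m`; the halfspaces containing some `a m` form the point `g⁺`
(`Axis.pole`), and `g⁻` is the pole of the inverse axis. Any other point contains some `a m`, hence
is attracted to `g⁺`, which gives `Axis.isPolePair_iff`.

*The formula.* Gromov products of two distinct poles are finite (`Axis.gromovSet_finite`), and the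
interval between such points contains a vertex (`exists_between`). An automorphism `f` with a vertex
`p` whose forward orbit lies on a geodesic has translation length `d(p, f p)`, also when the infimum
runs over all points of the complex (`translationLength_eq`). This applies, for large `n`, to `gⁿ`
and a vertex between `g⁻` and `g⁺`, to `hⁿ` and a vertex between `h⁻` and `h⁺`, and to `gⁿ hⁿ` and a
vertex `p` between `h⁻` and `g⁺`; in the last case the geodesic from `p` to `gⁿ hⁿ p` passes through
`gⁿ q` for a vertex `q` between `g⁻` and `h⁺`, since a halfspace preventing this would cut two
strongly separated halfspaces of one of the axes (`Axis.dist_eq_add_of_between`). Finally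
`d(p, gⁿ q)` differs from `d(v, gⁿ v)` by Gromov products with the poles
(`Axis.eventually_dist_pow`), and for a vertex between two points these add up to the Gromov
product of the two points (`Between.dist_add`). Summing up, the terms `d(v, gⁿ v)` and `d(v, hⁿ v)`
cancel and twice the cross ratio remains.
-/

namespace CubeComplex

variable {V : Type u} {X : CubeComplex V}

/-! ### Squares and cubes -/

/-- The vertex of the standard cube adjacent to `x` in the direction `i`. -/
def flip {n : ℕ} (x : Fin n → Bool) (i : Fin n) : Fin n → Bool := Function.update x i (!x i)

@[simp] theorem flip_same {n : ℕ} (x : Fin n → Bool) (i : Fin n) : flip x i i = !x i := by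
  simp [flip]

theorem flip_of_ne {n : ℕ} (x : Fin n → Bool) {i j : Fin n} (h : j ≠ i) : flip x i j = x j := by
  simp [flip, h]

theorem flip_ne {n : ℕ} (x : Fin n → Bool) (i : Fin n) : flip x i ≠ x := by
  intro h
  have := congrFun h i
  simp at this

theorem flip_comm {n : ℕ} (x : Fin n → Bool) {i j : Fin n} (h : i ≠ j) :
    flip (flip x i) j = flip (flip x j) i := by
  funext k
  by_cases hi : k = i
  · subst hi
    simp [flip_of_ne _ h]
  · by_cases hj : k = j
    · subst hj
      simp [flip_of_ne _ hi]
    · simp [flip_of_ne _ hi, flip_of_ne _ hj]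

theorem chart_adj {n : ℕ} {φ : (Fin n → Bool) → V} (hφ : IsCubeChart X.cubes φ)
    (x : Fin n → Bool) (i : Fin n) : X.skeleton.Adj (φ x) (φ (flip x i)) := by
  refine ⟨fun h => flip_ne x i (hφ.1 h).symm, ?_⟩
  refine (hφ.2 _ ?_).2 ⟨{i}ᶜ, x, ?_⟩
  · rintro _ (rfl | rfl) <;> exact ⟨_, rfl⟩
  · ext v
    constructor
    · rintro (rfl | rfl)
      · exact ⟨x, fun _ _ => rfl, rfl⟩
      · exact ⟨_, fun j hj => flip_of_ne _ hj, rfl⟩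
    · rintro ⟨y, hy, rfl⟩
      have key : y = x ∨ y = flip x i := by
        by_cases h : y i = x i
        · left
          funext j
          by_cases hj : j = i
          · rw [hj, h]
          · exact hy j hj
        · right
          funext j
          by_cases hj : j = i
          · subst hj
            rw [flip_same]
            revert h
            cases y j <;> cases x j <;> simp
          · rw [flip_of_ne _ hj]
            exact hy j hj
      rcases key with rfl | rfl <;> simp

theorem chart_square {n : ℕ} {φ : (Fin n → Bool) → V} (hφ : IsCubeChart X.cubes φ)
    (x : Fin n → Bool) {i j : Fin n} (hij : i ≠ j) :
    X.IsSquare (φ x) (φ (flip x i)) (φ (flip (flip x i) j)) (φ (flip x j)) where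
  ab := chart_adj hφ x i
  bc := chart_adj hφ _ j
  cd := by
    rw [flip_comm x hij]
    exact (chart_adj hφ _ i).symm
  da := (chart_adj hφ x j).symm
  ac := by
    intro h
    have := congrFun (hφ.1 h) j
    simp [flip_of_ne x hij.symm] at this
  bd := by
    intro h
    have := congrFun (hφ.1 h) i
    simp [flip_of_ne x hij] at this
  mem := by
    refine (hφ.2 _ ?_).2 ⟨{i, j}ᶜ, x, ?_⟩
    · rintro _ (rfl | rfl | rfl | rfl) <;> exact ⟨_, rfl⟩
    · ext v
      constructor
      · have h0 : ∀ k ∈ ({i, j}ᶜ : Set (Fin n)), k ≠ i ∧ k ≠ j := by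
          intro k hk
          simpa [not_or] using hk
        rintro (rfl | rfl | rfl | rfl)
        · exact ⟨x, fun _ _ => rfl, rfl⟩
        · exact ⟨_, fun k hk => flip_of_ne _ (h0 k hk).1, rfl⟩
        · exact ⟨_, fun k hk => (flip_of_ne _ (h0 k hk).2).trans (flip_of_ne _ (h0 k hk).1), rfl⟩
        · exact ⟨_, fun k hk => flip_of_ne _ (h0 k hk).2, rfl⟩
      · rintro ⟨y, hy, rfl⟩
        have hy' : ∀ k, k ≠ i → k ≠ j → y k = x k := fun k h1 h2 => hy k (by simp [h1, h2])
        have h1 : y i = x i ∨ y i = !x i := by cases y i <;> cases x i <;> simp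
        have h2 : y j = x j ∨ y j = !x j := by cases y j <;> cases x j <;> simp
        have ext' : ∀ z : Fin n → Bool, y i = z i → y j = z j →
            (∀ k, k ≠ i → k ≠ j → z k = x k) → y = z := by
          intro z hi hj hz
          funext k
          by_cases hki : k = i
          · rw [hki, hi]
          · by_cases hkj : k = j
            · rw [hkj, hj]
            · rw [hy' k hki hkj, hz k hki hkj]
        rcases h1 with h1 | h1 <;> rcases h2 with h2 | h2
        · rw [ext' x h1 h2 fun _ _ _ => rfl]; simp
        · rw [ext' (flip x j) (by rw [h1, flip_of_ne _ hij]) (by rw [h2, flip_same])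
            fun k _ hk => flip_of_ne _ hk]; simp
        · rw [ext' (flip x i) (by rw [h1, flip_same]) (by rw [h2, flip_of_ne _ hij.symm])
            fun k hk _ => flip_of_ne _ hk]; simp
        · rw [ext' (flip (flip x i) j) (by rw [h1, flip_of_ne _ hij, flip_same])
            (by rw [h2, flip_same, flip_of_ne _ hij.symm])
            fun k h h' => by rw [flip_of_ne _ h', flip_of_ne _ h]]; simp

/-- A face of a cube with two vertices is an edge of the cube, so neighbours in `X` that lie in a
common cube are neighbours in that cube. -/
theorem chart_neighbor {n : ℕ} {φ : (Fin n → Bool) → V} (hφ : IsCubeChart X.cubes φ)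
    {x : Fin n → Bool} {v : V} (hv : v ∈ Set.range φ) (h : X.skeleton.Adj (φ x) v) :
    ∃ i, v = φ (flip x i) := by
  obtain ⟨y, rfl⟩ := hv
  obtain ⟨S, a, hS⟩ := (hφ.2 {φ x, φ y} (by rintro _ (rfl | rfl) <;> exact ⟨_, rfl⟩)).1 h.2
  have hx : ∀ i ∈ S, x i = a i := by
    have : φ x ∈ φ '' {x | ∀ i ∈ S, x i = a i} := hS ▸ by simp
    obtain ⟨x', hx', e⟩ := this
    rwa [← hφ.1 e]
  have hy : ∀ i ∈ S, y i = a i := by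
    have : φ y ∈ φ '' {x | ∀ i ∈ S, x i = a i} := hS ▸ by simp
    obtain ⟨x', hx', e⟩ := this
    rwa [← hφ.1 e]
  have hne : x ≠ y := fun e => h.1 (by rw [e])
  obtain ⟨i, hi⟩ := Function.ne_iff.1 hne
  have hiS : i ∉ S := fun hi' => hi ((hx i hi').trans (hy i hi').symm)
  have hm : φ (flip x i) ∈ φ '' {x | ∀ i ∈ S, x i = a i} :=
    ⟨_, fun j hj => by rw [flip_of_ne _ (fun e : j = i => hiS (e ▸ hj)), hx j hj], rfl⟩
  rw [← hS] at hm
  rcases hm with hm | hm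
  · exact absurd (hφ.1 hm) (flip_ne x i)
  · exact ⟨i, hm.symm⟩

theorem ncard_cube {c : Set V} (hc : c ∈ X.cubes) : ∃ n, c.ncard = 2 ^ n := by
  obtain ⟨n, φ, hφ, rfl⟩ := X.exists_chart c hc
  refine ⟨n, ?_⟩
  rw [← Set.image_univ, Set.ncard_image_of_injective _ hφ.1]
  simp [Set.ncard_univ]

namespace IsSquare

variable {a b c d e : V}

theorem rotate (s : X.IsSquare a b c d) : X.IsSquare b c d a where
  ab := s.bc
  bc := s.cd
  cd := s.da
  da := s.ab
  ac := s.bd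
  bd := s.ac.symm
  mem := by
    have : ({b, c, d, a} : Set V) = {a, b, c, d} := by ext; simp; tauto
    rw [this]; exact s.mem

theorem reflect (s : X.IsSquare a b c d) : X.IsSquare a d c b where
  ab := s.da.symm
  bc := s.cd.symm
  cd := s.bc.symm
  da := s.ab.symm
  ac := s.ac
  bd := s.bd.symm
  mem := by
    have : ({a, d, c, b} : Set V) = {a, b, c, d} := by ext; simp; tauto
    rw [this]; exact s.mem

/-- Two squares with three common vertices meet in a cube, which has `2 ^ n` vertices. -/
theorem unique (s : X.IsSquare a b c d) (t : X.IsSquare a b e d) : c = e := by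
  by_contra hne
  have hi := X.inter_mem _ s.mem _ t.mem ⟨a, by simp, by simp⟩
  have : ({a, b, c, d} ∩ {a, b, e, d} : Set V) = {a, b, d} := by
    ext x
    constructor
    · rintro ⟨h1, h2⟩
      rcases h1 with rfl | rfl | rfl | rfl
      · simp
      · simp
      · rcases h2 with h | h | h | h
        · exact absurd h.symm s.ac
        · exact absurd h s.bc.1.symm
        · exact absurd h hne
        · exact absurd h s.cd.1
      · simp
    · rintro (rfl | rfl | rfl) <;> simp
  rw [this] at hi
  obtain ⟨n, hn⟩ := ncard_cube hi
  rw [Set.ncard_eq_three.2 ⟨a, b, d, s.ab.1, s.da.1.symm, s.bd, rfl⟩] at hn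
  rcases n with _ | _ | n
  · simp at hn
  · simp at hn
  · rw [pow_add] at hn; omega

end IsSquare

/-- Three squares pairwise sharing an edge at the common corner `o` span a 3-cube, whose vertex
opposite to `o` is `z`. -/
theorem exists_cube (hX : X.FlagLinks) {o a b c ab ac bc : V} (hab : X.IsSquare o a ab b)
    (hac : X.IsSquare o a ac c) (hbc : X.IsSquare o b bc c) :
    ∃ z, X.IsSquare a ab z ac ∧ X.IsSquare b ab z bc ∧ X.IsSquare c ac z bc := by
  classical
  obtain ⟨C, hC, ho, hS⟩ := hX o {a, b, c} (by
      intro v hv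
      simp only [Finset.mem_insert, Finset.mem_singleton] at hv
      rcases hv with rfl | rfl | rfl
      exacts [hab.ab, hbc.ab, hac.da.symm]) (by
    intro v hv w hw hne
    simp only [Finset.mem_insert, Finset.mem_singleton] at hv hw
    rcases hv with rfl | rfl | rfl <;> rcases hw with rfl | rfl | rfl
    · exact absurd rfl hne
    · exact ⟨_, hab.mem, by simp⟩
    · exact ⟨_, hac.mem, by simp⟩
    · exact ⟨_, hab.mem, by simp⟩
    · exact absurd rfl hne
    · exact ⟨_, hbc.mem, by simp⟩
    · exact ⟨_, hac.mem, by simp⟩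
    · exact ⟨_, hbc.mem, by simp⟩
    · exact absurd rfl hne)
  obtain ⟨n, φ, hφ, rfl⟩ := X.exists_chart C hC
  obtain ⟨x, rfl⟩ := ho
  obtain ⟨i, rfl⟩ := chart_neighbor hφ (hS a (by simp)) hab.ab
  obtain ⟨j, rfl⟩ := chart_neighbor hφ (hS b (by simp)) hbc.ab
  obtain ⟨k, rfl⟩ := chart_neighbor hφ (hS c (by simp)) hac.da.symm
  have hij : i ≠ j := fun e => hab.bd (by rw [e])
  have hik : i ≠ k := fun e => hac.bd (by rw [e])
  have hjk : j ≠ k := fun e => hbc.bd (by rw [e])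
  obtain rfl := hab.unique (chart_square hφ x hij)
  obtain rfl := hac.unique (chart_square hφ x hik)
  obtain rfl := hbc.unique (chart_square hφ x hjk)
  refine ⟨φ (flip (flip (flip x i) j) k), chart_square hφ _ hjk, ?_, ?_⟩
  · rw [flip_comm x hij]
    exact chart_square hφ _ hik
  · rw [flip_comm x hik, flip_comm (flip x i) hjk, flip_comm x hik, flip_comm x hjk]
    exact chart_square hφ _ hij

/-! ### Edge paths up to exchanging the sides of squares -/

/-- Edge paths, recorded as lists of vertices, that differ by a sequence of moves, each replacing
two consecutive edges of a square by the two opposite ones. -/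
inductive Shuffle (X : CubeComplex V) : List V → List V → Prop
  | refl (l : List V) : Shuffle X l l
  | symm {l m : List V} : Shuffle X l m → Shuffle X m l
  | trans {l m k : List V} : Shuffle X l m → Shuffle X m k → Shuffle X l k
  | cons (v : V) {l m : List V} : Shuffle X l m → Shuffle X (v :: l) (v :: m)
  | swap {v a w b : V} (s : X.IsSquare v a w b) (l : List V) :
      Shuffle X (v :: a :: w :: l) (v :: b :: w :: l)

namespace Shuffle

theorem length_eq {l m : List V} (h : Shuffle X l m) : l.length = m.length := by
  induction h with
  | refl => rfl
  | symm _ ih => exact ih.symm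
  | trans _ _ h1 h2 => exact h1.trans h2
  | cons _ _ ih => simp [ih]
  | swap => simp

theorem head_eq {l m : List V} (h : Shuffle X l m) : l.head? = m.head? := by
  induction h with
  | symm _ ih => exact ih.symm
  | trans _ _ h1 h2 => exact h1.trans h2
  | _ => rfl

theorem getLast_eq {l m : List V} (h : Shuffle X l m) : l.getLast? = m.getLast? := by
  induction h with
  | refl => rfl
  | symm _ ih => exact ih.symm
  | trans _ _ h1 h2 => exact h1.trans h2
  | cons v _ ih => rw [List.getLast?_cons, List.getLast?_cons, ih]
  | swap => simp [List.getLast?_cons]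

/-- The first steps of two shuffle-equivalent paths agree or span a square along which both paths
can be made to start. -/
theorem first_step (hX : X.FlagLinks) {l m : List V} (h : Shuffle X l m) :
    l = m ∨ ∃ v a p b q, l = v :: a :: p ∧ m = v :: b :: q ∧
      ((a = b ∧ Shuffle X (a :: p) (b :: q)) ∨ ∃ x r, X.IsSquare v a x b ∧
        Shuffle X (a :: p) (a :: x :: r) ∧ Shuffle X (b :: q) (b :: x :: r)) := by
  induction hn : l.length using Nat.strong_induction_on generalizing l m with
  | _ n IH =>
  induction h with
  | refl => exact .inl rfl
  | symm h ih =>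
    rcases ih (h.length_eq.trans hn) with rfl | ⟨v, a, p, b, q, rfl, rfl, h | ⟨x, r, s, h1, h2⟩⟩
    · exact .inl rfl
    · exact .inr ⟨v, b, q, a, p, rfl, rfl, .inl ⟨h.1.symm, h.2.symm⟩⟩
    · exact .inr ⟨v, b, q, a, p, rfl, rfl, .inr ⟨x, r, s.reflect, h2, h1⟩⟩
  | @cons v l m h _ =>
    rcases l with _ | ⟨a, p⟩ <;> rcases m with _ | ⟨b, q⟩
    · exact .inl rfl
    · simpa using h.length_eq
    · simpa using h.length_eq
    · obtain rfl : a = b := by simpa using h.head_eq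
      exact .inr ⟨v, a, p, a, q, rfl, rfl, .inl ⟨rfl, h⟩⟩
  | @swap v a w b s l =>
    exact .inr ⟨v, a, w :: l, b, w :: l, rfl, rfl, .inr ⟨w, l, s, .refl _, .refl _⟩⟩
  | trans h h' ih ih' =>
    rcases ih hn with rfl | ⟨v, a, p, b, q, rfl, rfl, h1⟩
    · exact ih' hn
    rcases ih' (h.length_eq.symm.trans hn) with rfl | ⟨v', b', q', c, r, e, rfl, h2⟩
    · exact .inr ⟨v, a, p, b, q, rfl, rfl, h1⟩
    obtain ⟨rfl, rfl, rfl⟩ : v = v' ∧ b = b' ∧ q = q' := by simpa using e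
    refine .inr ⟨v, a, p, c, r, rfl, rfl, ?_⟩
    rcases h1 with ⟨rfl, h1⟩ | ⟨x, k, s, h1, h1'⟩
    · rcases h2 with ⟨rfl, h2⟩ | ⟨y, k, t, h2, h2'⟩
      · exact .inl ⟨rfl, h1.trans h2⟩
      · exact .inr ⟨y, k, t, h1.trans h2, h2'⟩
    rcases h2 with ⟨rfl, h2⟩ | ⟨y, j, t, h2, h2'⟩
    · exact .inr ⟨x, k, s, h1, h2.symm.trans h1'⟩
    have key := IH (n - 1) (by simp at hn; omega) (h1'.symm.trans h2) (by
      have := h1'.length_eq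
      have := h.length_eq
      simp at *; omega)
    -- the two squares `v a x b` and `v b y c` share the edge `v b`
    have same : x = y → Shuffle X (x :: k) (y :: j) → (a = c ∧ Shuffle X (a :: p) (c :: r)) ∨
        ∃ x r', X.IsSquare v a x c ∧ Shuffle X (a :: p) (a :: x :: r') ∧
          Shuffle X (c :: r) (c :: x :: r') := by
      rintro rfl hs
      have e : a = c := by
        have s1 : X.IsSquare b v a x := s.rotate.rotate.rotate
        have s2 : X.IsSquare b v c x := t.rotate.reflect
        exact s1.unique s2
      subst e
      exact .inl ⟨rfl, h1.trans ((hs.cons a).trans h2'.symm)⟩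
    rcases key with e | ⟨b', x', k', y', j', e1, e2, e3⟩
    · obtain ⟨-, rfl, rfl⟩ : b = b ∧ x = y ∧ k = j := by simpa using e
      exact same rfl (.refl _)
    · obtain ⟨rfl, rfl, rfl⟩ : b = b' ∧ x = x' ∧ k = k' := by simpa using e1
      obtain ⟨-, rfl, rfl⟩ : b = b ∧ y = y' ∧ j = j' := by simpa using e2
      rcases e3 with ⟨e, hs⟩ | ⟨z, i, q0, hz, hz'⟩
      · exact same e hs
      · -- three squares at the corner `b`
        have s1 : X.IsSquare b v a x := s.rotate.rotate.rotate
        have s2 : X.IsSquare b v c y := t.rotate.reflect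
        obtain ⟨o, c1, c2, c3⟩ := exists_cube hX s1 s2 q0
        refine .inr ⟨o, z :: i, c1, ?_, ?_⟩
        · exact h1.trans ((hz.cons a).trans (.swap c2.rotate.reflect _))
        · exact h2'.trans ((hz'.cons c).trans (.swap c3.rotate.reflect _))

/-- A common first edge of two equivalent paths can be cancelled: the squares produced by
`first_step` join distinct neighbours. -/
theorem cancel (hX : X.FlagLinks) {v a : V} {p q : List V}
    (h : Shuffle X (v :: a :: p) (v :: a :: q)) : Shuffle X (a :: p) (a :: q) := by
  rcases h.first_step hX with e | ⟨v', a', p', b', q', e, e', h⟩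
  · obtain ⟨-, -, rfl⟩ : v = v ∧ a = a ∧ p = q := by simpa using e
    exact .refl _
  · obtain ⟨rfl, rfl, rfl⟩ : v = v' ∧ a = a' ∧ p = p' := by simpa using e
    obtain ⟨-, rfl, rfl⟩ : v = v ∧ a = b' ∧ q = q' := by simpa using e'
    rcases h with h | ⟨x, r, s, -⟩
    · exact h.2
    · exact absurd rfl s.bd

theorem exists_square (hX : X.FlagLinks) {v a b : V} {p q : List V} (hab : a ≠ b)
    (h : Shuffle X (v :: a :: p) (v :: b :: q)) : ∃ x r, X.IsSquare v a x b ∧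
      Shuffle X (a :: p) (a :: x :: r) ∧ Shuffle X (b :: q) (b :: x :: r) := by
  rcases h.first_step hX with e | ⟨v', a', p', b', q', e, e', h⟩
  · exact absurd (by simpa using e : a = b ∧ p = q).1 hab
  · obtain ⟨rfl, rfl, rfl⟩ : v = v' ∧ a = a' ∧ p = p' := by simpa using e
    obtain ⟨-, rfl, rfl⟩ : v = v ∧ b = b' ∧ q = q' := by simpa using e'
    rcases h with h | h
    · exact absurd h.1 hab
    · exact h

end Shuffle

/-- The path `l` can be shuffled so that its first edge leads to `w`. -/
def Descends (X : CubeComplex V) (w : V) : List V → Prop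
  | [] => False
  | v :: t => ∃ s, Shuffle X (v :: t) (v :: w :: s)

theorem Descends.congr {w : V} {l m : List V} (h : Shuffle X l m) (hl : Descends X w l) :
    Descends X w m := by
  rcases l with _ | ⟨v, t⟩ <;> rcases m with _ | ⟨v', t'⟩
  · exact hl
  · exact hl.elim
  · simpa using h.length_eq
  · obtain rfl : v = v' := by simpa using h.head_eq
    obtain ⟨s, hs⟩ := hl
    exact ⟨s, h.symm.trans hs⟩

/-- Nonempty edge paths that do not, even after shuffling, contain a backtrack. -/
def Reduced (X : CubeComplex V) : List V → Prop
  | [] => False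
  | [_] => True
  | w :: v :: t => X.skeleton.Adj w v ∧ Reduced X (v :: t) ∧ ¬ Descends X w (v :: t)

theorem Reduced.swap (hX : X.FlagLinks) {v a w b : V} (s : X.IsSquare v a w b) {l : List V}
    (h : Reduced X (v :: a :: w :: l)) : Reduced X (v :: b :: w :: l) := by
  obtain ⟨-, ⟨-, hw, ha⟩, hv⟩ := h
  refine ⟨s.da.symm, ⟨s.cd.symm, hw, ?_⟩, ?_⟩
  · rintro ⟨t, ht⟩
    exact hv ⟨_, (ht.cons a).trans (.swap s.rotate _)⟩
  · rintro ⟨t, ht⟩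
    obtain ⟨x, r, hs, h1, -⟩ := ht.exists_square hX s.ac.symm
    obtain rfl := hs.unique s.rotate.rotate.rotate.reflect
    exact ha ⟨r, h1⟩

/-- `Reduced` only refers to the given representative in its definition, but it is invariant under
shuffling. -/
theorem Reduced.congr (hX : X.FlagLinks) {l m : List V} (h : Shuffle X l m) :
    Reduced X l ↔ Reduced X m := by
  induction h with
  | refl => rfl
  | symm _ ih => exact ih.symm
  | trans _ _ h1 h2 => exact h1.trans h2
  | @cons v l m h ih =>
    rcases l with _ | ⟨a, p⟩ <;> rcases m with _ | ⟨b, q⟩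
    · rfl
    · simpa using h.length_eq
    · simpa using h.length_eq
    · obtain rfl : a = b := by simpa using h.head_eq
      have := (⟨Descends.congr h, Descends.congr h.symm⟩ :
        Descends X v (a :: p) ↔ Descends X v (a :: q))
      simp only [Reduced, ih, this]
  | swap s l => exact ⟨Reduced.swap hX s, Reduced.swap hX s.reflect⟩

theorem Reduced.tail {v w : V} {t : List V} (h : Reduced X (v :: w :: t)) : Reduced X (w :: t) :=
  h.2.1

open Classical in
/-- Prolong a path by an edge to the vertex `w` at its head, and reduce the result. -/
noncomputable def step (X : CubeComplex V) (w : V) : List V → List V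
  | [] => []
  | v :: t => if h : ∃ s, Shuffle X (v :: t) (v :: w :: s) then w :: h.choose else w :: v :: t

/-- By cancellation, the arbitrary choice in `step` does not matter up to shuffling. -/
theorem step_of_shuffle (hX : X.FlagLinks) {v w : V} {t s : List V}
    (h : Shuffle X (v :: t) (v :: w :: s)) : Shuffle X (step X w (v :: t)) (w :: s) := by
  have h' : ∃ s, Shuffle X (v :: t) (v :: w :: s) := ⟨s, h⟩
  rw [step, dif_pos h']
  exact (h'.choose_spec.symm.trans h).cancel hX

theorem step_of_not {v w : V} {t : List V} (h : ¬ Descends X w (v :: t)) :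
    step X w (v :: t) = w :: v :: t := dif_neg h

theorem step_congr (hX : X.FlagLinks) (w : V) {l m : List V} (h : Shuffle X l m) :
    Shuffle X (step X w l) (step X w m) := by
  rcases l with _ | ⟨v, t⟩ <;> rcases m with _ | ⟨v', t'⟩
  · exact .refl _
  · simpa using h.length_eq
  · simpa using h.length_eq
  · obtain rfl : v = v' := by simpa using h.head_eq
    by_cases hd : Descends X w (v :: t)
    · obtain ⟨s, hs⟩ := hd
      exact (step_of_shuffle hX hs).trans (step_of_shuffle hX (h.symm.trans hs)).symm
    · rw [step_of_not hd, step_of_not fun h' => hd (h'.congr h.symm)]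
      exact h.cons w

theorem step_back (hX : X.FlagLinks) {v w : V} {t : List V} (h : Reduced X (v :: t)) :
    Shuffle X (step X v (step X w (v :: t))) (v :: t) := by
  by_cases hd : Descends X w (v :: t)
  · obtain ⟨s, hs⟩ := hd
    refine (step_congr hX v (step_of_shuffle hX hs)).trans ?_
    rw [step_of_not ((Reduced.congr hX hs).1 h).2.2]
    exact hs.symm
  · rw [step_of_not hd]
    exact step_of_shuffle hX (.refl _)

theorem step_square_of_descends (hX : X.FlagLinks) {v a w b : V} {t : List V}
    (s : X.IsSquare v a w b) (ha : Descends X a (v :: t)) (hb : ¬ Descends X b (v :: t)) :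
    Shuffle X (step X w (step X a (v :: t))) (step X w (step X b (v :: t))) := by
  obtain ⟨p, hp⟩ := ha
  refine (step_congr hX w (step_of_shuffle hX hp)).trans ?_
  rw [step_of_not hb]
  have h1 : Shuffle X (b :: v :: t) (b :: w :: a :: p) :=
    (hp.cons b).trans (.swap s.rotate.rotate.rotate _)
  refine Shuffle.trans ?_ (step_of_shuffle hX h1).symm
  rw [step_of_not]
  · exact .refl _
  · rintro ⟨r, hr⟩
    exact hb ⟨_, hp.trans ((hr.cons v).trans (.swap s _))⟩

theorem not_descends_of_square (hX : X.FlagLinks) {v a w b : V} {t : List V}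
    (s : X.IsSquare v a w b) (hb : ¬ Descends X b (v :: t)) : ¬ Descends X w (a :: v :: t) := by
  rintro ⟨r, hr⟩
  obtain ⟨x, r', hs, h1, -⟩ := hr.exists_square hX s.ac
  obtain rfl := hs.unique s.rotate.reflect
  exact hb ⟨_, h1⟩

/-- Prolonging a path along either half of the boundary of a square gives the same result. If the
path descends neither to `a` nor to `b`, the prolongations do not cancel and differ by a swap. -/
theorem step_square (hX : X.FlagLinks) {v a w b : V} {t : List V} (s : X.IsSquare v a w b) :
    Shuffle X (step X w (step X a (v :: t))) (step X w (step X b (v :: t))) := by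
  by_cases ha : Descends X a (v :: t) <;> by_cases hb : Descends X b (v :: t)
  · obtain ⟨p, hp⟩ := ha
    obtain ⟨q, hq⟩ := hb
    obtain ⟨x, r, hs, h1, h2⟩ := (hp.symm.trans hq).exists_square hX s.bd
    obtain rfl := hs.unique s
    refine (step_congr hX x ((step_of_shuffle hX hp).trans h1)).trans ?_
    refine Shuffle.trans ?_ (step_congr hX x ((step_of_shuffle hX hq).trans h2)).symm
    exact (step_of_shuffle hX (.refl _)).trans (step_of_shuffle hX (.refl _)).symm
  · exact step_square_of_descends hX s ha hb
  · exact (step_square_of_descends hX s.reflect hb ha).symm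
  · rw [step_of_not ha, step_of_not hb, step_of_not (not_descends_of_square hX s hb),
      step_of_not (not_descends_of_square hX s.reflect ha)]
    exact .swap s.rotate.rotate.reflect _

/-- Prolong a reduced path by a walk, reducing at every step. -/
noncomputable def act : ∀ {u v : V}, X.skeleton.Walk u v → List V → List V
  | _, _, .nil, l => l
  | _, _, .cons (v := w) _ p, l => act p (step X w l)

theorem act_append {u v w : V} (p : X.skeleton.Walk u v) (q : X.skeleton.Walk v w) (l : List V) :
    act (p.append q) l = act q (act p l) := by
  induction p generalizing l with
  | nil => rfl
  | cons e p ih => exact ih q _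

theorem act_congr (hX : X.FlagLinks) {u v : V} (p : X.skeleton.Walk u v) {l m : List V}
    (h : Shuffle X l m) : Shuffle X (act p l) (act p m) := by
  induction p generalizing l m with
  | nil => exact h
  | cons e p ih => exact ih (step_congr hX _ h)

/-- The reduced paths from `v` to `o`. -/
structure ReducedFrom (X : CubeComplex V) (o v : V) (l : List V) : Prop where
  reduced : Reduced X l
  head : l.head? = some v
  last : l.getLast? = some o

theorem ReducedFrom.exists_cons {o v : V} {l : List V} (h : ReducedFrom X o v l) :
    ∃ t, l = v :: t := by
  rcases l with _ | ⟨a, t⟩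
  · exact h.reduced.elim
  · obtain rfl : a = v := by simpa using h.head
    exact ⟨t, rfl⟩

theorem ReducedFrom.congr (hX : X.FlagLinks) {o v : V} {l m : List V} (h : ReducedFrom X o v l)
    (hs : Shuffle X l m) : ReducedFrom X o v m :=
  ⟨(Reduced.congr hX hs).1 h.reduced, hs.head_eq ▸ h.head, hs.getLast_eq ▸ h.last⟩

theorem ReducedFrom.tail {o v w : V} {t : List V} (h : ReducedFrom X o v (v :: w :: t)) :
    ReducedFrom X o w (w :: t) :=
  ⟨h.reduced.tail, rfl, by simpa [List.getLast?_cons] using h.last⟩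

theorem ReducedFrom.cons {o v w : V} {t : List V} (h : ReducedFrom X o v (v :: t))
    (hw : X.skeleton.Adj v w) (hd : ¬ Descends X w (v :: t)) :
    ReducedFrom X o w (w :: v :: t) :=
  ⟨⟨hw.symm, h.reduced, hd⟩, rfl, by
    have := h.last
    rw [List.getLast?_cons] at this ⊢
    rw [List.getLast?_cons]
    simpa using this⟩

theorem ReducedFrom.step (hX : X.FlagLinks) {o v w : V} {l : List V} (h : ReducedFrom X o v l)
    (hw : X.skeleton.Adj v w) : ReducedFrom X o w (step X w l) := by
  obtain ⟨t, rfl⟩ := h.exists_cons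
  by_cases hd : Descends X w (v :: t)
  · obtain ⟨s, hs⟩ := hd
    exact (h.congr hX hs).tail.congr hX (step_of_shuffle hX hs).symm
  · rw [step_of_not hd]
    exact h.cons hw hd

theorem ReducedFrom.act (hX : X.FlagLinks) {o u v : V} (p : X.skeleton.Walk u v) {l : List V}
    (h : ReducedFrom X o u l) : ReducedFrom X o v (act p l) := by
  induction p generalizing l with
  | nil => exact h
  | cons e p ih => exact ih (h.step hX e)

theorem length_step_le (w : V) (l : List V) : (step X w l).length ≤ l.length + 1 := by
  rcases l with _ | ⟨v, t⟩
  · simp [step]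
  · by_cases h : ∃ s, Shuffle X (v :: t) (v :: w :: s)
    · rw [step, dif_pos h]
      have := h.choose_spec.length_eq
      simp only [List.length_cons] at *
      omega
    · rw [step, dif_neg h]
      simp

theorem length_act_le {u v : V} (p : X.skeleton.Walk u v) (l : List V) :
    (act p l).length ≤ l.length + p.length := by
  induction p generalizing l with
  | nil => simp [act]
  | @cons u v w e p ih =>
    have h1 := ih (step X v l)
    have h2 := length_step_le (X := X) v l
    rw [SimpleGraph.Walk.length_cons]
    exact h1.trans (by omega)

/-- Homotopic walks act in the same way on reduced paths up to shuffling. -/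
theorem act_homotopic (hX : X.FlagLinks) {u v : V} {p q : X.skeleton.Walk u v}
    (h : X.Homotopic p q) {o : V} {l : List V} (hl : ReducedFrom X o u l) :
    Shuffle X (act p l) (act q l) := by
  induction h generalizing l with
  | refl p => exact .refl _
  | symm _ ih => exact (ih hl).symm
  | trans _ _ h1 h2 => exact (h1 hl).trans (h2 hl)
  | backtrack p e q =>
    rw [act_append, act_append]
    obtain ⟨t, ht⟩ := (hl.act hX p).exists_cons
    have hr := (hl.act hX p).reduced
    rw [ht] at hr ⊢
    exact act_congr hX q (step_back hX hr)
  | square p s q =>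
    rw [act_append, act_append]
    obtain ⟨t, ht⟩ := (hl.act hX p).exists_cons
    rw [ht]
    exact act_congr hX q (step_square hX s)

theorem ReducedFrom.exists_walk (hX : X.FlagLinks) {o v : V} {l : List V}
    (h : ReducedFrom X o v l) :
    ∃ p : X.skeleton.Walk o v, p.length + 1 = l.length ∧ Shuffle X (CubeComplex.act p [o]) l := by
  induction l generalizing v with
  | nil => exact h.reduced.elim
  | cons a t ih =>
    obtain rfl : a = v := by simpa using h.head
    rcases t with _ | ⟨b, t⟩
    · obtain rfl : a = o := by simpa using h.last
      exact ⟨.nil, rfl, .refl _⟩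
    · obtain ⟨p, hp, hs⟩ := ih h.tail
      refine ⟨p.concat h.reduced.1.symm, by simpa using hp, ?_⟩
      rw [SimpleGraph.Walk.concat_eq_append, act_append]
      refine (step_congr hX a hs).trans ?_
      rw [step_of_not h.reduced.2.2]
      exact .refl _

/-- Here simple connectedness enters: any two reduced paths with the same endpoints agree up to
shuffling. -/
theorem ReducedFrom.shuffle (hX : X.IsCAT0) {o v : V} {l m : List V} (h : ReducedFrom X o v l)
    (h' : ReducedFrom X o v m) : Shuffle X l m := by
  obtain ⟨p, -, hp⟩ := h.exists_walk hX.flagLinks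
  obtain ⟨q, -, hq⟩ := h'.exists_walk hX.flagLinks
  have ho : ReducedFrom X o o [o] := ⟨trivial, rfl, rfl⟩
  have h1 := act_homotopic hX.flagLinks (hX.simplyConnected.2 o (p.append q.reverse)) ho
  have h2 := act_congr hX.flagLinks q h1
  rw [act_append] at h2
  have h3 := act_homotopic hX.flagLinks (hX.simplyConnected.2 v (q.reverse.append q))
    (ho.act hX.flagLinks p)
  rw [act_append] at h3
  exact hp.symm.trans (h3.symm.trans (h2.trans hq))

theorem exists_reducedFrom (hX : X.IsCAT0) (o v : V) : ∃ l, ReducedFrom X o v l := by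
  obtain ⟨p⟩ := hX.simplyConnected.1.preconnected o v
  exact ⟨_, (⟨trivial, rfl, rfl⟩ : ReducedFrom X o o [o]).act hX.flagLinks p⟩

theorem ReducedFrom.length_eq (hX : X.IsCAT0) {o v : V} {l : List V} (h : ReducedFrom X o v l) :
    l.length = X.skeleton.dist o v + 1 := by
  obtain ⟨p, hp, -⟩ := h.exists_walk hX.flagLinks
  obtain ⟨q, hq⟩ := (hX.simplyConnected.1.preconnected o v).exists_walk_length_eq_dist
  have h1 := SimpleGraph.dist_le p
  have h2 := (h.shuffle hX ((⟨trivial, rfl, rfl⟩ : ReducedFrom X o o [o]).act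
    hX.flagLinks q)).length_eq
  have h3 := length_act_le q [o]
  simp only [List.length_singleton] at h3
  omega

/-! ### The graph metric: bipartiteness and the quadrangle condition -/

/-- The 1-skeleton is bipartite. -/
theorem dist_adj (hX : X.IsCAT0) (o : V) {v w : V} (h : X.skeleton.Adj v w) :
    X.skeleton.dist o w = X.skeleton.dist o v + 1 ∨
      X.skeleton.dist o v = X.skeleton.dist o w + 1 := by
  obtain ⟨l, hl⟩ := exists_reducedFrom hX o v
  obtain ⟨t, rfl⟩ := hl.exists_cons
  have h0 := hl.length_eq hX
  by_cases hd : Descends X w (v :: t)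
  · obtain ⟨s, hs⟩ := hd
    have h1 := (hl.congr hX.flagLinks hs).tail.length_eq hX
    have h2 := hs.length_eq
    simp only [List.length_cons] at *
    omega
  · have h1 := (hl.cons h hd).length_eq hX
    simp only [List.length_cons] at *
    omega

/-- The quadrangle condition: two neighbours of `v` that are both closer to `o` span with `v` a
square whose fourth vertex is still closer to `o`. -/
theorem quadrangle (hX : X.IsCAT0) {o v a b : V} (ha : X.skeleton.Adj v a)
    (hb : X.skeleton.Adj v b) (hab : a ≠ b) (hda : X.skeleton.dist o v = X.skeleton.dist o a + 1)
    (hdb : X.skeleton.dist o v = X.skeleton.dist o b + 1) :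
    ∃ x, X.IsSquare v a x b ∧ X.skeleton.dist o a = X.skeleton.dist o x + 1 := by
  have key : ∀ c, X.skeleton.Adj v c → X.skeleton.dist o v = X.skeleton.dist o c + 1 →
      ∃ t, ReducedFrom X o c (c :: t) ∧ ReducedFrom X o v (v :: c :: t) := by
    intro c hc hd
    obtain ⟨l, hl⟩ := exists_reducedFrom hX o c
    obtain ⟨t, rfl⟩ := hl.exists_cons
    refine ⟨t, hl, hl.cons hc.symm ?_⟩
    rintro ⟨s, hs⟩
    have h1 := (hl.congr hX.flagLinks hs).tail.length_eq hX
    have h2 := hs.length_eq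
    have h3 := hl.length_eq hX
    simp only [List.length_cons] at *
    omega
  obtain ⟨p, hp, hp'⟩ := key a ha hda
  obtain ⟨q, hq, hq'⟩ := key b hb hdb
  obtain ⟨x, r, s, h1, -⟩ := (hp'.shuffle hX hq').exists_square hX.flagLinks hab
  refine ⟨x, s, ?_⟩
  have h2 := (hp.congr hX.flagLinks h1).length_eq hX
  have h3 := (hp.congr hX.flagLinks h1).tail.length_eq hX
  simp only [List.length_cons] at *
  omega

/-! ### Halfspaces -/

theorem exists_adj_closer (hX : X.IsCAT0) {x u : V} {k : ℕ} (h : X.skeleton.dist x u = k + 1) :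
    ∃ y, X.skeleton.Adj x y ∧ X.skeleton.dist y u = k := by
  obtain ⟨p, hp⟩ := (hX.simplyConnected.1.preconnected x u).exists_walk_length_eq_dist
  cases p with
  | nil => simp at h
  | @cons _ y _ e p =>
    refine ⟨y, e, ?_⟩
    have h1 := SimpleGraph.dist_le p
    rw [SimpleGraph.Walk.length_cons] at hp
    have h2 := dist_adj hX u e
    rw [SimpleGraph.dist_comm (u := u), SimpleGraph.dist_comm (u := u)] at h2
    omega

/-- The vertices closer to `u` than to `v`. For adjacent `u`, `v` this is the side containing `u`
of the hyperplane dual to the edge `uv`. -/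
def side (X : CubeComplex V) (u v : V) : Set V := {x | X.skeleton.dist x u < X.skeleton.dist x v}

theorem mem_side {u v x : V} : x ∈ X.side u v ↔ X.skeleton.dist x u < X.skeleton.dist x v := Iff.rfl

theorem left_mem_side {u v : V} (h : X.skeleton.Adj u v) : u ∈ X.side u v := by
  simp [side, SimpleGraph.dist_eq_one_iff_adj.2 h]

theorem right_notMem_side {u v : V} : v ∉ X.side u v := by
  simp [side]

theorem side_compl (hX : X.IsCAT0) {u v : V} (h : X.skeleton.Adj u v) :
    (X.side u v)ᶜ = X.side v u := by
  ext x
  have := dist_adj hX x h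
  rw [Set.mem_compl_iff, mem_side, mem_side]
  omega

/-- Otherwise `b` and `d` would both be farther from some `x` than `a` and `c`; but then the fourth
vertex of the square spanned by `b`, `a`, `c`, which is `d`, would be closer to `x` than `a`. -/
theorem side_subset_of_isSquare (hX : X.IsCAT0) {a b c d : V} (s : X.IsSquare a b c d) :
    X.side a b ⊆ X.side d c := by
  intro x hx
  rw [mem_side] at *
  by_contra hn
  have h1 := dist_adj hX x s.ab
  have h2 := dist_adj hX x s.bc
  have h3 := dist_adj hX x s.cd
  have h4 := dist_adj hX x s.da
  obtain ⟨y, hy, hy'⟩ := quadrangle hX (o := x) s.ab.symm s.bc s.ac (by omega) (by omega)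
  obtain rfl := hy.unique s.rotate.reflect
  omega

theorem side_eq_of_isSquare (hX : X.IsCAT0) {a b c d : V} (s : X.IsSquare a b c d) :
    X.side a b = X.side d c :=
  (side_subset_of_isSquare hX s).antisymm (side_subset_of_isSquare hX s.reflect.rotate)

/-- An edge leaving the set of vertices closer to `u` than to `v` belongs to the hyperplane dual to
`uv`: by the quadrangle condition it can be pushed across squares towards `uv`. -/
theorem mem_hyperplane_and_side_eq (hX : X.IsCAT0) {u v : V} (huv : X.skeleton.Adj u v) (k : ℕ)
    {a b : V} (hab : X.skeleton.Adj a b) (ha : a ∈ X.side u v) (hb : b ∉ X.side u v)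
    (hk : X.skeleton.dist a u = k) :
    s(a, b) ∈ X.hyperplane s(u, v) ∧ X.side a b = X.side u v := by
  have hconn := hX.simplyConnected.1
  induction k generalizing a b with
  | zero =>
    obtain rfl := (hconn.preconnected a u).dist_eq_zero_iff.1 hk
    have h1 := dist_adj hX b huv
    have h2 : X.skeleton.dist b a = 1 := SimpleGraph.dist_eq_one_iff_adj.2 hab.symm
    rw [mem_side] at hb
    obtain rfl := (hconn.preconnected b v).dist_eq_zero_iff.1 (by omega)
    exact ⟨.refl _, rfl⟩
  | succ k ih =>
    rw [mem_side] at ha hb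
    have h1 := dist_adj hX a huv
    have h2 := dist_adj hX b huv
    have h3 := dist_adj hX u hab
    have h4 := dist_adj hX v hab
    have eau := X.skeleton.dist_comm (u := a) (v := u)
    have eav := X.skeleton.dist_comm (u := a) (v := v)
    have ebu := X.skeleton.dist_comm (u := b) (v := u)
    have ebv := X.skeleton.dist_comm (u := b) (v := v)
    obtain ⟨c, hbc, hc⟩ := exists_adj_closer hX (k := k) (x := b) (u := v) (by omega)
    have h5 := dist_adj hX c huv
    have h6 := dist_adj hX u hbc
    have ecu := X.skeleton.dist_comm (u := c) (v := u)
    obtain ⟨x, s, hx⟩ := quadrangle hX (o := u) hab.symm hbc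
      (by rintro rfl; omega) (by omega) (by omega)
    have h7 := dist_adj hX v s.bc
    have exu := X.skeleton.dist_comm (u := x) (v := u)
    have exv := X.skeleton.dist_comm (u := x) (v := v)
    obtain ⟨h8, h9⟩ := ih (a := x) (b := c) s.cd (by rw [mem_side]; omega)
      (by rw [mem_side]; omega) (by omega)
    have t : X.IsSquare a b c x := s.rotate.reflect
    exact ⟨.trans _ _ _ h8 (.symm _ _ (.rel _ _ ⟨a, b, c, x, t, rfl, rfl⟩)),
      (side_eq_of_isSquare hX t).trans h9⟩

/-- A halfspace is determined by any oriented edge entering it. -/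
theorem side_eq_side (hX : X.IsCAT0) {u v a b : V} (huv : X.skeleton.Adj u v)
    (hab : X.skeleton.Adj a b) (ha : a ∈ X.side u v) (hb : b ∉ X.side u v) :
    X.side u v = X.side a b := (mem_hyperplane_and_side_eq hX huv _ hab ha hb rfl).2.symm

theorem side_of_mem_hyperplane (hX : X.IsCAT0) {e f : Sym2 V} (h : f ∈ X.hyperplane e)
    (S : Set V) : (∃ a b, e = s(a, b) ∧ X.skeleton.Adj a b ∧ X.side a b = S) ↔
      ∃ a b, f = s(a, b) ∧ X.skeleton.Adj a b ∧ X.side a b = S := by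
  change Relation.EqvGen X.Opposite e f at h
  induction h with
  | refl => rfl
  | symm _ _ _ ih => exact ih.symm
  | trans _ _ _ _ _ h1 h2 => exact h1.trans h2
  | rel e f h =>
    obtain ⟨a, b, c, d, s, rfl, rfl⟩ := h
    have key : ∀ {a b c d : V}, X.IsSquare a b c d →
        (∃ a' b', s(a, b) = s(a', b') ∧ X.skeleton.Adj a' b' ∧ X.side a' b' = S) →
        ∃ a' b', s(d, c) = s(a', b') ∧ X.skeleton.Adj a' b' ∧ X.side a' b' = S := by
      rintro a b c d s ⟨a', b', h, h', rfl⟩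
      rcases Sym2.eq_iff.1 h with ⟨rfl, rfl⟩ | ⟨rfl, rfl⟩
      · exact ⟨d, c, rfl, s.cd.symm, (side_eq_of_isSquare hX s).symm⟩
      · refine ⟨c, d, Sym2.eq_swap, s.cd, (side_eq_of_isSquare hX ?_).symm⟩
        exact s.rotate.reflect
    exact ⟨key s, key s.reflect.rotate⟩

theorem reachable_iff_mem_side (hX : X.IsCAT0) {u v x : V} (huv : X.skeleton.Adj u v) :
    (X.skeleton.deleteEdges (X.hyperplane s(u, v))).Reachable u x ↔ x ∈ X.side u v := by
  constructor
  · rintro ⟨p⟩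
    have key : ∀ {a b : V}, (X.skeleton.deleteEdges (X.hyperplane s(u, v))).Walk a b →
        a ∈ X.side u v → b ∈ X.side u v := by
      intro a b p
      induction p with
      | nil => exact id
      | @cons a b _ e p ih =>
        intro ha
        rw [SimpleGraph.deleteEdges_adj] at e
        refine ih ?_
        by_contra hb
        exact e.2 (mem_hyperplane_and_side_eq hX huv _ e.1 ha hb rfl).1
    exact key p (left_mem_side huv)
  · intro hx
    induction hk : X.skeleton.dist x u generalizing x with
    | zero =>
      rw [(hX.simplyConnected.1.preconnected x u).dist_eq_zero_iff.1 hk]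
    | succ k ih =>
      obtain ⟨y, hxy, hy⟩ := exists_adj_closer hX hk
      have h1 := dist_adj hX v hxy
      have e1 := X.skeleton.dist_comm (u := x) (v := v)
      have e2 := X.skeleton.dist_comm (u := y) (v := v)
      rw [mem_side] at hx
      have hy' : y ∈ X.side u v := by rw [mem_side]; omega
      refine (ih hy' hy).trans (SimpleGraph.Adj.reachable ?_)
      rw [SimpleGraph.deleteEdges_adj]
      refine ⟨hxy.symm, fun hm => ?_⟩
      obtain ⟨a, b, e, hab, hs⟩ := (side_of_mem_hyperplane hX hm (X.side u v)).1
        ⟨u, v, rfl, huv, rfl⟩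
      have ha := hs ▸ left_mem_side hab
      have hb := hs ▸ right_notMem_side (X := X) (u := a) (v := b)
      rcases Sym2.eq_iff.1 e with ⟨rfl, rfl⟩ | ⟨rfl, rfl⟩
      · exact hb hx
      · exact hb hy'

theorem isSide_iff (hX : X.IsCAT0) {u v : V} (huv : X.skeleton.Adj u v) {h : Set V} :
    X.IsSide s(u, v) h ↔ h = X.side u v ∨ h = X.side v u := by
  have key : ∀ {u v x : V}, X.skeleton.Adj u v → x ∈ X.side u v →
      {w | (X.skeleton.deleteEdges (X.hyperplane s(u, v))).Reachable x w} = X.side u v := by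
    intro u v x huv hx
    ext w
    have h1 := (reachable_iff_mem_side hX huv).2 hx
    rw [← reachable_iff_mem_side hX huv]
    exact ⟨fun h => h1.trans h, fun h => h1.symm.trans h⟩
  constructor
  · rintro ⟨x, rfl⟩
    by_cases hx : x ∈ X.side u v
    · exact .inl (key huv hx)
    · right
      have hx' : x ∈ X.side v u := side_compl hX huv ▸ hx
      rw [Sym2.eq_swap, key huv.symm hx']
  · rintro (rfl | rfl)
    · exact ⟨u, (key huv (left_mem_side huv)).symm⟩
    · refine ⟨v, ?_⟩
      rw [Sym2.eq_swap, key huv.symm (left_mem_side huv.symm)]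

theorem isHalfspace_iff (hX : X.IsCAT0) {h : Set V} :
    X.IsHalfspace h ↔ ∃ u v, X.skeleton.Adj u v ∧ h = X.side u v := by
  constructor
  · rintro ⟨e, he, hs⟩
    induction e with
    | _ u v =>
      rcases (isSide_iff hX he).1 hs with rfl | rfl
      · exact ⟨u, v, he, rfl⟩
      · exact ⟨v, u, SimpleGraph.Adj.symm he, rfl⟩
  · rintro ⟨u, v, huv, rfl⟩
    exact ⟨s(u, v), huv, (isSide_iff hX huv).2 (.inl rfl)⟩

theorem isHalfspace_side (hX : X.IsCAT0) {u v : V} (h : X.skeleton.Adj u v) :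
    X.IsHalfspace (X.side u v) := (isHalfspace_iff hX).2 ⟨u, v, h, rfl⟩

theorem IsHalfspace.compl (hX : X.IsCAT0) {h : Set V} (hh : X.IsHalfspace h) :
    X.IsHalfspace hᶜ := by
  obtain ⟨u, v, huv, rfl⟩ := (isHalfspace_iff hX).1 hh
  rw [side_compl hX huv]
  exact isHalfspace_side hX huv.symm

theorem IsHalfspace.nonempty {h : Set V} (hh : X.IsHalfspace h) : h.Nonempty := by
  obtain ⟨e, he, v, rfl⟩ := hh
  exact ⟨v, SimpleGraph.Reachable.refl v⟩

theorem IsHalfspace.eq_side (hX : X.IsCAT0) {h : Set V} (hh : X.IsHalfspace h) {a b : V}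
    (hab : X.skeleton.Adj a b) (ha : a ∈ h) (hb : b ∉ h) : h = X.side a b := by
  obtain ⟨u, v, huv, rfl⟩ := (isHalfspace_iff hX).1 hh
  exact side_eq_side hX huv hab ha hb

/-- The halfspaces containing `x` but not `y`; they correspond to the hyperplanes separating `x`
from `y`. -/
def sep (X : CubeComplex V) (x y : V) : Set (Set V) := {h | X.IsHalfspace h ∧ x ∈ h ∧ y ∉ h}

theorem sep_finite_ncard (hX : X.IsCAT0) (x y : V) :
    (X.sep x y).Finite ∧ (X.sep x y).ncard = X.skeleton.dist x y := by
  induction hk : X.skeleton.dist x y generalizing y with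
  | zero =>
    obtain rfl := (hX.simplyConnected.1.preconnected x y).dist_eq_zero_iff.1 hk
    have : X.sep x x = ∅ := Set.eq_empty_iff_forall_notMem.2 fun h hh => hh.2.2 hh.2.1
    simp [this]
  | succ k ih =>
    rw [SimpleGraph.dist_comm] at hk
    obtain ⟨z, hyz, hz⟩ := exists_adj_closer hX hk
    rw [SimpleGraph.dist_comm] at hz hk
    obtain ⟨h1, h2⟩ := ih z hz
    have key : X.sep x y = insert (X.side z y) (X.sep x z) := by
      ext h
      constructor
      · rintro ⟨hh, hx, hy⟩
        by_cases hzh : z ∈ h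
        · exact .inl (hh.eq_side hX hyz.symm hzh hy)
        · exact .inr ⟨hh, hx, hzh⟩
      · rintro (rfl | ⟨hh, hx, hzh⟩)
        · exact ⟨isHalfspace_side hX hyz.symm, by rw [mem_side]; omega, right_notMem_side⟩
        · refine ⟨hh, hx, fun hy => ?_⟩
          rw [hh.eq_side hX hyz hy hzh, mem_side] at hx
          omega
    rw [key]
    refine ⟨h1.insert _, ?_⟩
    rw [Set.ncard_insert_of_notMem (fun h => h.2.2 (left_mem_side hyz.symm)) h1, h2]

theorem sep_finite (hX : X.IsCAT0) (x y : V) : (X.sep x y).Finite := (sep_finite_ncard hX x y).1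

theorem ncard_sep (hX : X.IsCAT0) (x y : V) : (X.sep x y).ncard = X.skeleton.dist x y :=
  (sep_finite_ncard hX x y).2

/-- A vertex `m` lies on a geodesic from `x` to `y` as soon as no halfspace cuts it off from both
endpoints. -/
theorem dist_eq_add (hX : X.IsCAT0) {x m y : V}
    (h : ∀ j, X.IsHalfspace j → m ∈ j → x ∉ j → y ∈ j) :
    X.skeleton.dist x y = X.skeleton.dist x m + X.skeleton.dist m y := by
  rw [← ncard_sep hX, ← ncard_sep hX, ← ncard_sep hX,
    ← Set.ncard_union_eq _ (sep_finite hX x m) (sep_finite hX m y)]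
  · congr 1
    ext j
    constructor
    · rintro ⟨hj, hx, hy⟩
      by_cases hm : m ∈ j
      · exact .inr ⟨hj, hm, hy⟩
      · exact .inl ⟨hj, hx, hm⟩
    · rintro (⟨hj, hx, hm⟩ | ⟨hj, hm, hy⟩)
      · refine ⟨hj, hx, fun hy => ?_⟩
        exact h _ (hj.compl hX) hm (fun h => h hx) hy
      · refine ⟨hj, ?_, hy⟩
        by_contra hx
        exact hy (h j hj hm hx)
  · rw [Set.disjoint_left]
    exact fun j h1 h2 => h1.2.2 h2.2.1

/-! ### Automorphisms and points of the Roller compactification -/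

theorem dist_map_le (hX : X.IsCAT0) (g : X.Aut) (u v : V) :
    X.skeleton.dist ((g : Equiv.Perm V) u) ((g : Equiv.Perm V) v) ≤ X.skeleton.dist u v := by
  obtain ⟨p, hp⟩ := (hX.simplyConnected.1.preconnected u v).exists_walk_length_eq_dist
  rw [← hp]
  let f : X.skeleton →g X.skeleton := ⟨(g : Equiv.Perm V), X.adj_map g⟩
  rw [← SimpleGraph.Walk.length_map f p]
  exact SimpleGraph.dist_le _

theorem dist_map (hX : X.IsCAT0) (g : X.Aut) (u v : V) :
    X.skeleton.dist ((g : Equiv.Perm V) u) ((g : Equiv.Perm V) v) = X.skeleton.dist u v := by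
  refine le_antisymm (dist_map_le hX g u v) ?_
  simpa using dist_map_le hX g⁻¹ ((g : Equiv.Perm V) u) ((g : Equiv.Perm V) v)

theorem dist_inv_pow (hX : X.IsCAT0) (g : X.Aut) (n : ℕ) (p q : V) :
    X.skeleton.dist p (((g⁻¹ ^ n : X.Aut) : Equiv.Perm V) q) =
      X.skeleton.dist q (((g ^ n : X.Aut) : Equiv.Perm V) p) := by
  rw [← dist_map hX (g ^ n), SimpleGraph.dist_comm]
  congr 1
  rw [inv_pow, ← Equiv.Perm.mul_apply, ← Subgroup.coe_mul, mul_inv_cancel]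
  rfl

theorem IsHalfspace.preimage (g : X.Aut) {h : Set V} (hh : X.IsHalfspace h) :
    X.IsHalfspace ((g : Equiv.Perm V) ⁻¹' h) := by
  have := X.isHalfspace_map g⁻¹ hh
  convert this using 1
  ext v
  simp [Equiv.Perm.inv_def]

namespace Roller

theorem mem_or_compl_mem (hX : X.IsCAT0) (x : X.Roller) {h : Set V} (hh : X.IsHalfspace h) :
    h ∈ x.sides ∨ hᶜ ∈ x.sides := by
  obtain ⟨u, v, huv, rfl⟩ := (isHalfspace_iff hX).1 hh
  obtain ⟨k, hk, hs⟩ := x.exists_side s(u, v) huv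
  rw [side_compl hX huv]
  rcases (isSide_iff hX huv).1 hs with rfl | rfl
  · exact .inl hk
  · exact .inr hk

theorem compl_mem_iff (hX : X.IsCAT0) (x : X.Roller) {h : Set V} (hh : X.IsHalfspace h) :
    hᶜ ∈ x.sides ↔ h ∉ x.sides := by
  refine ⟨fun h1 h2 => ?_, fun h1 => (x.mem_or_compl_mem hX hh).resolve_left h1⟩
  obtain ⟨v, hv, hv'⟩ := x.inter_nonempty _ h1 _ h2
  exact hv hv'

theorem mem_of_subset (hX : X.IsCAT0) (x : X.Roller) {h k : Set V} (hh : h ∈ x.sides)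
    (hk : X.IsHalfspace k) (hhk : h ⊆ k) : k ∈ x.sides := by
  by_contra hn
  obtain ⟨v, hv, hv'⟩ := x.inter_nonempty _ hh _ ((x.compl_mem_iff hX hk).2 hn)
  exact hv' (hhk hv)

theorem eq_of_subset (hX : X.IsCAT0) {x y : X.Roller} (h : x.sides ⊆ y.sides) : x = y := by
  refine Roller.ext (h.antisymm fun j hj => ?_)
  by_contra hn
  have hj' := y.isHalfspace j hj
  exact (y.compl_mem_iff hX hj').1 (h ((x.compl_mem_iff hX hj').2 hn)) hj

theorem exists_mem_compl_mem (hX : X.IsCAT0) {x y : X.Roller} (h : x ≠ y) :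
    ∃ j, j ∈ x.sides ∧ jᶜ ∈ y.sides := by
  by_contra! hn
  refine h (eq_of_subset hX fun j hj => ?_)
  by_contra hj'
  exact hn j hj ((y.compl_mem_iff hX (x.isHalfspace j hj)).2 hj')

theorem mem_rollerMap (g : X.Aut) (x : X.Roller) {h : Set V} :
    h ∈ (X.rollerMap g x).sides ↔ (g : Equiv.Perm V) ⁻¹' h ∈ x.sides := by
  constructor
  · rintro ⟨k, hk, rfl⟩
    rwa [Set.preimage_image_eq _ (g : Equiv.Perm V).injective]
  · intro hk
    exact ⟨_, hk, Set.image_preimage_eq _ (g : Equiv.Perm V).surjective⟩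

theorem rollerMap_pow_eq {g : X.Aut} {x : X.Roller} (h : X.rollerMap g x = x) (n : ℕ) :
    X.rollerMap (g ^ n) x = x := by
  induction n with
  | zero =>
    refine Roller.ext (Set.ext fun j => ?_)
    rw [Roller.mem_rollerMap]
    simp
  | succ n ih =>
    refine Roller.ext (Set.ext fun j => ?_)
    have h1 := Roller.mem_rollerMap g x (h := ((g ^ n : X.Aut) : Equiv.Perm V) ⁻¹' j)
    have h2 := Roller.mem_rollerMap (g ^ n) x (h := j)
    rw [h] at h1
    rw [ih] at h2
    rw [Roller.mem_rollerMap, pow_succ]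
    exact h1.symm.trans h2.symm

theorem tendsto_iff {f : ℕ → X.Roller} {x : X.Roller} :
    Tendsto f atTop (𝓝 x) ↔ ∀ h, ∀ᶠ n in atTop, (h ∈ (f n).sides ↔ h ∈ x.sides) := by
  let _ : TopologicalSpace Prop := ⊥
  have : DiscreteTopology Prop := ⟨rfl⟩
  rw [nhds_induced, tendsto_comap_iff]
  refine (tendsto_pi_nhds ).trans (forall_congr' fun h => ?_)
  rw [nhds_discrete, tendsto_pure]
  simp only [Function.comp, eq_iff_iff]

end Roller

/-! ### Axes of strongly separated halfspaces -/

/-- A bi-infinite chain of halfspaces shifted by `g`, any two consecutive members of which bound a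
strongly separated pair: no halfspace cuts both `a (m + 1)` and the complement of `a m`. -/
structure Axis (X : CubeComplex V) (g : X.Aut) (a : ℤ → Set V) : Prop where
  isHalfspace : ∀ m, X.IsHalfspace (a m)
  map : ∀ m v, (g : Equiv.Perm V) v ∈ a (m + 1) ↔ v ∈ a m
  ssubset : ∀ m, a (m + 1) ⊂ a m
  deep : ∀ m j, X.IsHalfspace j → (j ∩ a (m + 1)).Nonempty → (jᶜ ∩ a (m + 1)).Nonempty →
    (j ∩ (a m)ᶜ).Nonempty → (jᶜ ∩ (a m)ᶜ).Nonempty → False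

/-- The translates of `h₁` form an axis: a halfspace cutting `a (m + 1)` and the complement of `a m`
would also cut both sides of the translate of `h₂` that lies between them. -/
theorem NeatlyContracting.exists_axis {g : X.Aut} (hg : X.NeatlyContracting g) :
    ∃ a, X.Axis g a := by
  obtain ⟨h₁, h₂, hh₁, hh₂, h12, h21, hne, hs, -⟩ := hg
  have hsub : (g : Equiv.Perm V) '' h₁ ⊆ h₁ := h12.trans h21
  have hz : ∀ (m : ℤ) (v : V), ((g ^ (-(m + 1)) : X.Aut) : Equiv.Perm V) ((g : Equiv.Perm V) v) =
      ((g ^ (-m) : X.Aut) : Equiv.Perm V) v := by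
    intro m v
    have : g ^ (-m) = g ^ (-(m + 1)) * g := by
      rw [← zpow_add_one]; congr 1; ring
    rw [this]; rfl
  have hz' : ∀ (m : ℤ) (v : V), (g : Equiv.Perm V) (((g ^ (-(m + 1)) : X.Aut) : Equiv.Perm V) v) =
      ((g ^ (-m) : X.Aut) : Equiv.Perm V) v := by
    intro m v
    have : g ^ (-m) = g * g ^ (-(m + 1)) := by
      rw [← zpow_one_add]; congr 1; ring
    rw [this]; rfl
  have hinv : ∀ (m : ℤ) (v : V), ((g ^ (-m) : X.Aut) : Equiv.Perm V)
      (((g ^ m : X.Aut) : Equiv.Perm V) v) = v := by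
    intro m v
    have : g ^ (-m) * g ^ m = 1 := by rw [← zpow_add]; simp
    exact congrArg (fun k : X.Aut => (k : Equiv.Perm V) v) this
  refine ⟨fun m => ((g ^ (-m) : X.Aut) : Equiv.Perm V) ⁻¹' h₁, fun m => hh₁.preimage _, ?_, ?_, ?_⟩
  · intro m v
    rw [Set.mem_preimage, Set.mem_preimage, hz]
  · intro m
    refine ⟨fun v hv => ?_, fun hle => hne (hsub.antisymm fun w hw => ?_)⟩
    · rw [Set.mem_preimage, ← hz']
      exact hsub ⟨_, hv, rfl⟩
    · have := hle (show ((g ^ m : X.Aut) : Equiv.Perm V) w ∈ _ from by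
        rw [Set.mem_preimage, hinv]; exact hw)
      refine ⟨_, this, ?_⟩
      rw [hz', hinv]
  · intro m j hj h1 h2 h3 h4
    refine hs.2.2.2 ⟨((g ^ m : X.Aut) : Equiv.Perm V) ⁻¹' j, hj.preimage _, ?_⟩
    have hinv' : ∀ v : V, ((g ^ m : X.Aut) : Equiv.Perm V)
        (((g ^ (-m) : X.Aut) : Equiv.Perm V) v) = v := by
      intro v
      have := hinv (-m) v
      rwa [neg_neg] at this
    have k1 : ∀ k : Set V, (k ∩ (fun m : ℤ => ((g ^ (-m) : X.Aut) : Equiv.Perm V) ⁻¹' h₁)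
        (m + 1)).Nonempty → ((((g ^ m : X.Aut) : Equiv.Perm V) ⁻¹' k) ∩ h₂).Nonempty := by
      rintro k ⟨v, hv, hv'⟩
      refine ⟨((g ^ (-m) : X.Aut) : Equiv.Perm V) v, ?_, ?_⟩
      · rw [Set.mem_preimage, hinv']; exact hv
      · rw [← hz']; exact h12 ⟨_, hv', rfl⟩
    have k2 : ∀ k : Set V, (k ∩ ((fun m : ℤ => ((g ^ (-m) : X.Aut) : Equiv.Perm V) ⁻¹' h₁)
        m)ᶜ).Nonempty → ((((g ^ m : X.Aut) : Equiv.Perm V) ⁻¹' k) ∩ h₁ᶜ).Nonempty := by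
      rintro k ⟨v, hv, hv'⟩
      refine ⟨((g ^ (-m) : X.Aut) : Equiv.Perm V) v, ?_, hv'⟩
      rw [Set.mem_preimage, hinv']; exact hv
    have k3 := Set.compl_subset_compl.2 h21
    refine ⟨⟨k1 _ h1, k1 _ h2, (k2 _ h3).mono (Set.inter_subset_inter_right _ k3),
      (k2 _ h4).mono (Set.inter_subset_inter_right _ k3)⟩, k2 _ h3, k2 _ h4, ?_, ?_⟩
    · rw [compl_compl]
      exact (k1 _ h1).mono (Set.inter_subset_inter_right _ h21)
    · rw [compl_compl]
      exact (k1 _ h2).mono (Set.inter_subset_inter_right _ h21)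

namespace Axis

variable {g : X.Aut} {a : ℤ → Set V}

theorem inv (hX : X.IsCAT0) (A : X.Axis g a) : X.Axis g⁻¹ (fun m => (a (-m))ᶜ) where
  isHalfspace m := (A.isHalfspace _).compl hX
  map m v := by
    have := A.map (-(m + 1)) (((g⁻¹ : X.Aut) : Equiv.Perm V) v)
    rw [Set.mem_compl_iff, Set.mem_compl_iff]
    refine not_congr ?_
    rw [← this]
    simp
  ssubset m := by
    have := A.ssubset (-(m + 1))
    rw [show -(m + 1) + 1 = -m by ring] at this
    exact compl_lt_compl_iff_lt.2 this
  deep m j hj h1 h2 h3 h4 := by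
    refine A.deep (-(m + 1)) j hj ?_ ?_ h1 h2
    · rw [show -(m + 1) + 1 = -m by ring]
      simpa using h3
    · rw [show -(m + 1) + 1 = -m by ring]
      simpa using h4

theorem strictAnti (A : X.Axis g a) : StrictAnti a :=
  strictAnti_int_of_succ_lt A.ssubset

theorem anti (A : X.Axis g a) {m k : ℤ} (h : m ≤ k) : a k ⊆ a m := A.strictAnti.antitone h

theorem deep_of_lt (A : X.Axis g a) {m k : ℤ} (hmk : m < k) {j : Set V} (hj : X.IsHalfspace j)
    (h1 : (j ∩ a k).Nonempty) (h2 : (jᶜ ∩ a k).Nonempty)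
    (h3 : (j ∩ (a m)ᶜ).Nonempty) (h4 : (jᶜ ∩ (a m)ᶜ).Nonempty) : False :=
  A.deep m j hj (h1.mono (Set.inter_subset_inter_right _ (A.anti hmk)))
    (h2.mono (Set.inter_subset_inter_right _ (A.anti hmk))) h3 h4

theorem pow_mem (A : X.Axis g a) (n : ℕ) (m : ℤ) (v : V) :
    ((g ^ n : X.Aut) : Equiv.Perm V) v ∈ a m ↔ v ∈ a (m - n) := by
  induction n generalizing m with
  | zero => simp
  | succ n ih =>
    rw [pow_succ', Subgroup.coe_mul, Equiv.Perm.mul_apply]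
    have := A.map (m - 1) (((g ^ n : X.Aut) : Equiv.Perm V) v)
    rw [sub_add_cancel] at this
    rw [this, ih]
    push_cast
    rw [show m - 1 - (n : ℤ) = m - (n + 1) by ring]

theorem exists_forall_notMem (hX : X.IsCAT0) (A : X.Axis g a) (v : V) :
    ∃ M : ℤ, ∀ m ≥ M, v ∉ a m := by
  have key : ∃ M, v ∉ a M := by
    by_contra! hall
    obtain ⟨u, hu⟩ := ((A.isHalfspace 0).compl hX).nonempty
    refine Set.infinite_of_injective_forall_mem (s := X.sep v u) (f := fun n : ℕ => a n)
      (fun m n h => by exact_mod_cast A.strictAnti.injective h)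
      (fun n => ⟨A.isHalfspace n, hall n, fun h => hu (A.anti (by positivity) h)⟩)
      (sep_finite hX v u)
  obtain ⟨M, hM⟩ := key
  exact ⟨M, fun m hm h => hM (A.anti hm h)⟩

theorem exists_forall_mem (hX : X.IsCAT0) (A : X.Axis g a) (v : V) :
    ∃ M : ℤ, ∀ m ≤ M, v ∈ a m := by
  obtain ⟨M, hM⟩ := (A.inv hX).exists_forall_notMem hX v
  refine ⟨-M, fun m hm => ?_⟩
  have := hM (-m) (by omega)
  rwa [neg_neg, Set.notMem_compl_iff] at this

/-- Some member of the axis misses a vertex of `j` and a vertex of its complement, and then `j`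
cannot cut the next one. -/
theorem exists_subset_or_subset_compl (hX : X.IsCAT0) (A : X.Axis g a) {j : Set V}
    (hj : X.IsHalfspace j) : ∃ m, a m ⊆ j ∨ a m ⊆ jᶜ := by
  obtain ⟨u, hu⟩ := hj.nonempty
  obtain ⟨w, hw⟩ := (hj.compl hX).nonempty
  obtain ⟨M, hM⟩ := A.exists_forall_notMem hX u
  obtain ⟨N, hN⟩ := A.exists_forall_notMem hX w
  refine ⟨max M N + 1, ?_⟩
  by_contra! hn
  obtain ⟨h1, h2⟩ := hn
  obtain ⟨x, hx, hx'⟩ := Set.not_subset.1 h1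
  obtain ⟨y, hy, hy'⟩ := Set.not_subset.1 h2
  exact A.deep (max M N) j hj ⟨y, not_not.1 hy', hy⟩ ⟨x, hx', hx⟩ ⟨u, hu, hM _ (le_max_left _ _)⟩
    ⟨w, hw, hN _ (le_max_right _ _)⟩

/-- The point of the Roller boundary towards which an axis points. -/
def pole (hX : X.IsCAT0) (A : X.Axis g a) : X.Roller where
  sides := {j | X.IsHalfspace j ∧ ∃ m, a m ⊆ j}
  isHalfspace _ h := h.1
  inter_nonempty := by
    rintro h ⟨-, m, hm⟩ k ⟨-, n, hn⟩
    obtain ⟨v, hv⟩ := (A.isHalfspace (max m n)).nonempty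
    exact ⟨v, hm (A.anti (le_max_left _ _) hv), hn (A.anti (le_max_right _ _) hv)⟩
  exists_side := by
    intro e he
    induction e with
    | _ u v =>
      have hs := isHalfspace_side hX he
      obtain ⟨m, hm | hm⟩ := A.exists_subset_or_subset_compl hX hs
      · exact ⟨_, ⟨hs, m, hm⟩, (isSide_iff hX he).2 (.inl rfl)⟩
      · exact ⟨_, ⟨hs.compl hX, m, hm⟩, (isSide_iff hX he).2 (.inr (side_compl hX he))⟩

theorem mem_pole (hX : X.IsCAT0) (A : X.Axis g a) (m : ℤ) : a m ∈ (A.pole hX).sides :=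
  ⟨A.isHalfspace m, m, subset_rfl⟩

theorem compl_mem_pole_inv (hX : X.IsCAT0) (A : X.Axis g a) (m : ℤ) :
    (a m)ᶜ ∈ ((A.inv hX).pole hX).sides := by
  simpa using (A.inv hX).mem_pole hX (-m)

theorem pole_ne (hX : X.IsCAT0) (A : X.Axis g a) : (A.inv hX).pole hX ≠ A.pole hX := by
  intro h
  exact (Roller.compl_mem_iff hX _ (A.isHalfspace 0)).1 (A.compl_mem_pole_inv hX 0)
    (h ▸ A.mem_pole hX 0)

theorem pole_mem_regularBoundary (hX : X.IsCAT0) (A : X.Axis g a) :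
    A.pole hX ∈ X.regularBoundary := by
  refine ⟨fun v hv => ?_, fun n => a n, fun n => ⟨A.mem_pole hX n, ?_, ?_⟩⟩
  · obtain ⟨M, hM⟩ := A.exists_forall_notMem hX v
    have := A.mem_pole hX M
    rw [hv] at this
    exact hM M le_rfl this.2
  · exact_mod_cast A.ssubset n
  · refine ⟨(A.isHalfspace n).compl hX, A.isHalfspace _, ?_, ?_⟩
    · rw [Set.disjoint_compl_left_iff_subset]
      exact_mod_cast (A.ssubset n).subset
    · rintro ⟨j, hj, h1, h2⟩
      push_cast at h2
      exact A.deep n j hj h2.1 h2.2.1 h1.1 h1.2.1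

theorem rollerMap_pole (hX : X.IsCAT0) (A : X.Axis g a) :
    X.rollerMap g (A.pole hX) = A.pole hX := by
  refine (Roller.eq_of_subset hX fun j hj => ?_).symm
  obtain ⟨hj, m, hm⟩ := hj
  rw [Roller.mem_rollerMap]
  refine ⟨hj.preimage g, m - 1, fun v hv => hm ?_⟩
  have := (A.map (m - 1) v).2 hv
  rwa [sub_add_cancel] at this

theorem eq_pole_or_exists (hX : X.IsCAT0) (A : X.Axis g a) (x : X.Roller) :
    x = A.pole hX ∨ ∃ m, (a m)ᶜ ∈ x.sides := by
  by_cases h : ∃ m, (a m)ᶜ ∈ x.sides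
  · exact .inr h
  · left
    refine (Roller.eq_of_subset hX ?_).symm
    rintro j ⟨hj, m, hm⟩
    refine x.mem_of_subset hX ?_ hj hm
    by_contra hn
    exact h ⟨m, (x.compl_mem_iff hX (A.isHalfspace m)).2 hn⟩

theorem eq_pole_inv_or_exists (hX : X.IsCAT0) (A : X.Axis g a) (x : X.Roller) :
    x = (A.inv hX).pole hX ∨ ∃ m, a m ∈ x.sides := by
  rcases (A.inv hX).eq_pole_or_exists hX x with h | ⟨m, hm⟩
  · exact .inl h
  · rw [compl_compl] at hm
    exact .inr ⟨_, hm⟩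

theorem eventually_mem (hX : X.IsCAT0) (A : X.Axis g a) {x : X.Roller} {m : ℤ}
    (hx : a m ∈ x.sides) {j : Set V} (hj : j ∈ (A.pole hX).sides) :
    ∀ᶠ n : ℕ in atTop, j ∈ (X.rollerMap (g ^ n) x).sides := by
  obtain ⟨hj, k, hk⟩ := hj
  filter_upwards [eventually_ge_atTop (k - m).toNat] with n hn
  rw [Roller.mem_rollerMap]
  refine x.mem_of_subset hX hx (hj.preimage _) fun v hv => hk ?_
  rw [A.pow_mem]
  exact A.anti (by omega) hv

theorem eventually_mem_iff (hX : X.IsCAT0) (A : X.Axis g a) {x : X.Roller} {m : ℤ}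
    (hx : a m ∈ x.sides) (j : Set V) :
    ∀ᶠ n : ℕ in atTop, (j ∈ (X.rollerMap (g ^ n) x).sides ↔ j ∈ (A.pole hX).sides) := by
  by_cases hj : X.IsHalfspace j
  · rcases (A.pole hX).mem_or_compl_mem hX hj with h | h
    · filter_upwards [A.eventually_mem hX hx h] with n hn
      exact ⟨fun _ => h, fun _ => hn⟩
    · filter_upwards [A.eventually_mem hX hx h] with n hn
      have h1 := (Roller.compl_mem_iff hX _ hj).1 h
      have h2 := (Roller.compl_mem_iff hX _ hj).1 hn
      exact ⟨fun h => absurd h h2, fun h => absurd h h1⟩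
  · exact .of_forall fun n =>
      ⟨fun h => absurd (Roller.isHalfspace _ _ h) hj, fun h => absurd (Roller.isHalfspace _ _ h) hj⟩

theorem tendsto_pole (hX : X.IsCAT0) (A : X.Axis g a) {x : X.Roller}
    (hx : x ≠ (A.inv hX).pole hX) :
    Tendsto (fun n : ℕ => X.rollerMap (g ^ n) x) atTop (𝓝 (A.pole hX)) := by
  obtain ⟨m, hm⟩ := (A.eq_pole_inv_or_exists hX x).resolve_left hx
  exact Roller.tendsto_iff.2 (A.eventually_mem_iff hX hm)

theorem tendsto_pole_inv (hX : X.IsCAT0) (A : X.Axis g a) {x : X.Roller}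
    (hx : x ≠ A.pole hX) :
    Tendsto (fun n : ℕ => X.rollerMap (g⁻¹ ^ n) x) atTop (𝓝 ((A.inv hX).pole hX)) := by
  obtain ⟨m, hm⟩ := (A.eq_pole_or_exists hX x).resolve_left hx
  refine Roller.tendsto_iff.2 ((A.inv hX).eventually_mem_iff hX (m := -m) ?_)
  rwa [neg_neg]

theorem eq_or_eq_of_fixed (hX : X.IsCAT0) (A : X.Axis g a) {x : X.Roller}
    (h : X.rollerMap g x = x) : x = (A.inv hX).pole hX ∨ x = A.pole hX := by
  rcases A.eq_pole_inv_or_exists hX x with h' | ⟨m, hm⟩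
  · exact .inl h'
  · refine .inr (Roller.eq_of_subset hX fun j hj => ?_).symm
    obtain ⟨n, hn⟩ := (A.eventually_mem hX hm hj).exists
    rwa [Roller.rollerMap_pow_eq h] at hn

theorem rollerMap_pole_inv (hX : X.IsCAT0) (A : X.Axis g a) :
    X.rollerMap g ((A.inv hX).pole hX) = (A.inv hX).pole hX := by
  refine Roller.ext (Set.ext fun j => ?_)
  have h := (A.inv hX).rollerMap_pole hX
  rw [Roller.mem_rollerMap]
  nth_rewrite 1 [← h]
  rw [Roller.mem_rollerMap, ← Set.preimage_comp]
  have : ((g : Equiv.Perm V) : V → V) ∘ ((g⁻¹ : X.Aut) : Equiv.Perm V) = id := by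
    funext v; simp
  rw [this, Set.preimage_id]

/-- The dynamical characterization of the poles; the attraction of an arbitrary vertex tells the
attracting point from the repelling one. -/
theorem isPolePair_iff (hX : X.IsCAT0) (A : X.Axis g a) {m p : X.Roller} :
    X.IsPolePair g m p ↔ m = (A.inv hX).pole hX ∧ p = A.pole hX := by
  have hfix : {x | x ∈ X.regularBoundary ∧ X.rollerMap g x = x} =
      {(A.inv hX).pole hX, A.pole hX} := by
    ext x
    constructor
    · rintro ⟨-, h⟩
      exact A.eq_or_eq_of_fixed hX h
    · rintro (rfl | rfl)
      · exact ⟨(A.inv hX).pole_mem_regularBoundary hX, A.rollerMap_pole_inv hX⟩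
      · exact ⟨A.pole_mem_regularBoundary hX, A.rollerMap_pole hX⟩
  constructor
  · intro h
    obtain ⟨v⟩ := hX.simplyConnected.1.nonempty
    have hv : ∀ x ∈ X.regularBoundary, X.vertexPoint v ≠ x := fun x hx e => hx.1 v e.symm
    have hmem : ∀ x ∈ ({m, p} : Set X.Roller), x ∈ X.regularBoundary := by
      intro x hx
      rw [← h.fixed] at hx
      exact hx.1
    have hp : p = A.pole hX := by
      have h1 := Roller.tendsto_iff.1
        (h.attracting (X.vertexPoint v) (hv m (hmem m (by simp))) (hv p (hmem p (by simp))))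
      have h2 := Roller.tendsto_iff.1 (A.tendsto_pole hX
        (hv _ ((A.inv hX).pole_mem_regularBoundary hX)))
      refine Roller.ext (Set.ext fun j => ?_)
      obtain ⟨n, h3, h4⟩ := ((h1 j).and (h2 j)).exists
      exact h3.symm.trans h4
    refine ⟨?_, hp⟩
    have : m ∈ ({(A.inv hX).pole hX, A.pole hX} : Set X.Roller) := by
      rw [← hfix, h.fixed]; simp
    rcases this with h' | h'
    · exact h'
    · exact absurd (h'.trans hp.symm) h.ne
  · rintro ⟨rfl, rfl⟩
    exact ⟨A.pole_ne hX, hfix, fun x h1 _ => A.tendsto_pole hX h1,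
      fun x _ h2 => A.tendsto_pole_inv hX h2⟩

theorem existsUnique_isPolePair (hX : X.IsCAT0) (A : X.Axis g a) :
    ∃! q : X.Roller × X.Roller, X.IsPolePair g q.1 q.2 := by
  refine ⟨((A.inv hX).pole hX, A.pole hX), (A.isPolePair_iff hX).2 ⟨rfl, rfl⟩, ?_⟩
  rintro ⟨m, p⟩ h
  obtain ⟨h1, h2⟩ := (A.isPolePair_iff hX).1 h
  exact Prod.ext h1 h2

end Axis

/-! ### Multilinear extensions of functions on the vertices of a cube -/

/-- The multilinear extension to `[0,1]ⁿ` of a function on the vertices of the cube. -/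
def multilinearExt {n : ℕ} (f : (Fin n → Bool) → ℝ) (t : Fin n → unitInterval) : ℝ :=
  ∑ x : Fin n → Bool, (∏ i, (if x i then (t i : ℝ) else 1 - (t i : ℝ))) * f x

theorem multilinearExt_succ {n : ℕ} (f : (Fin (n + 1) → Bool) → ℝ)
    (t : Fin (n + 1) → unitInterval) :
    multilinearExt f t = (t 0 : ℝ) * multilinearExt (fun x => f (Fin.cons true x)) (Fin.tail t) +
      (1 - (t 0 : ℝ)) * multilinearExt (fun x => f (Fin.cons false x)) (Fin.tail t) := by
  unfold multilinearExt
  rw [← (Fin.consEquiv (fun _ => Bool)).sum_comp, Fintype.sum_prod_type, Fintype.sum_bool,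
    Finset.mul_sum, Finset.mul_sum]
  congr 1 <;> refine Finset.sum_congr rfl fun x _ => ?_
  · simp [Fin.consEquiv, Fin.prod_univ_succ, Fin.tail, mul_assoc]
  · simp [Fin.consEquiv, Fin.prod_univ_succ, Fin.tail, mul_assoc]

theorem multilinearExt_sub {n : ℕ} (f g : (Fin n → Bool) → ℝ) (t : Fin n → unitInterval) :
    multilinearExt (fun x => f x - g x) t = multilinearExt f t - multilinearExt g t := by
  simp [multilinearExt, mul_sub, Finset.sum_sub_distrib]

theorem abs_convex_comb_le {c : unitInterval} {a b C : ℝ} (ha : |a| ≤ C) (hb : |b| ≤ C) :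
    |(c : ℝ) * a + (1 - (c : ℝ)) * b| ≤ C := by
  have h0 := c.2.1
  have h1 := c.2.2
  rw [abs_le] at *
  constructor <;> nlinarith

theorem abs_multilinearExt_le {n : ℕ} {f : (Fin n → Bool) → ℝ} {C : ℝ} (hf : ∀ x, |f x| ≤ C)
    (t : Fin n → unitInterval) : |multilinearExt f t| ≤ C := by
  induction n with
  | zero => simpa [multilinearExt] using hf _
  | succ n ih =>
    rw [multilinearExt_succ]
    exact abs_convex_comb_le (ih (fun x => hf _) _) (ih (fun x => hf _) _)

theorem flip_cons_zero {n : ℕ} (b : Bool) (x : Fin n → Bool) :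
    flip (Fin.cons b x : Fin (n + 1) → Bool) 0 = Fin.cons (!b) x := by
  rw [flip, Fin.cons_zero, Fin.update_cons_zero]

theorem flip_cons_succ {n : ℕ} (b : Bool) (x : Fin n → Bool) (i : Fin n) :
    flip (Fin.cons b x : Fin (n + 1) → Bool) i.succ = Fin.cons b (flip x i) := by
  rw [flip, Fin.cons_succ, ← Fin.cons_update]
  rfl

/-- If `f` changes by at most 1 along each edge of the cube, then its multilinear extension is
1-Lipschitz for the `ℓ¹` metric. -/
theorem abs_multilinearExt_sub_le {n : ℕ} {f : (Fin n → Bool) → ℝ}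
    (hf : ∀ x i, |f (flip x i) - f x| ≤ 1) (s t : Fin n → unitInterval) :
    |multilinearExt f s - multilinearExt f t| ≤ ∑ i, |(s i : ℝ) - (t i : ℝ)| := by
  induction n with
  | zero => simp [multilinearExt]
  | succ n ih =>
    have hb : ∀ b : Bool, |multilinearExt (fun x => f (Fin.cons b x)) (Fin.tail s) -
        multilinearExt (fun x => f (Fin.cons b x)) (Fin.tail t)| ≤
          ∑ i, |((Fin.tail s i : unitInterval) : ℝ) - (Fin.tail t i : unitInterval)| := by
      intro b
      refine ih (fun x i => ?_) _ _
      rw [← flip_cons_succ]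
      exact hf _ _
    have hd : |multilinearExt (fun x => f (Fin.cons true x)) (Fin.tail s) -
        multilinearExt (fun x => f (Fin.cons false x)) (Fin.tail s)| ≤ 1 := by
      rw [← multilinearExt_sub]
      refine abs_multilinearExt_le (fun x => ?_) _
      have := hf (Fin.cons false x) 0
      rwa [flip_cons_zero] at this
    rw [multilinearExt_succ f s, multilinearExt_succ f t, Fin.sum_univ_succ]
    have h1 := abs_convex_comb_le (c := t 0) (hb true) (hb false)
    have h2 := mul_le_mul_of_nonneg_left hd (abs_nonneg ((s 0 : ℝ) - (t 0 : ℝ)))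
    rw [← abs_mul, mul_one] at h2
    refine le_trans (le_of_eq ?_) ((abs_add_le _ _).trans (add_le_add h2 h1))
    congr 1
    ring

/-! ### The combinatorial metric on vertices -/

/-- The linear extension of a function on the vertices to finitely supported functions. -/
noncomputable def pairing (N p : V → ℝ) : ℝ := ∑' v, p v * N v

theorem pairing_cubePoint (N : V → ℝ) {n : ℕ} (φ : (Fin n → Bool) → V)
    (t : Fin n → unitInterval) :
    pairing N (cubePoint φ t) = multilinearExt (fun x => N (φ x)) t := by
  classical
  unfold pairing cubePoint multilinearExt
  have h : ∀ x : Fin n → Bool, HasSum (fun v => (if φ x = v then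
      ∏ i, (if x i then (t i : ℝ) else 1 - (t i : ℝ)) else 0) * N v)
      ((∏ i, (if x i then (t i : ℝ) else 1 - (t i : ℝ))) * N (φ x)) := by
    intro x
    convert hasSum_single (φ x) ?_ using 1
    · simp
    · intro v hv
      rw [if_neg (Ne.symm hv), zero_mul]
  have h' := hasSum_sum (s := Finset.univ) fun x _ => h x
  rw [← h'.tsum_eq]
  refine tsum_congr fun v => ?_
  rw [Finset.sum_mul]

/-- The distance from `u`, extended multilinearly to the cubes, is 1-Lipschitz along strings. -/
theorem StringLength.pairing_le (hX : X.IsCAT0) (u : V) {p q : V → ℝ} {r : ℝ}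
    (h : X.StringLength p q r) :
    pairing (fun v => (X.skeleton.dist u v : ℝ)) q -
      pairing (fun v => (X.skeleton.dist u v : ℝ)) p ≤ r := by
  induction h with
  | nil => simp
  | cons φ hφ s t _ ih =>
    have := abs_multilinearExt_sub_le (f := fun x => (X.skeleton.dist u (φ x) : ℝ)) (fun x i => by
      rcases dist_adj hX u (chart_adj hφ x i) with h | h <;> simp [h]) s t
    rw [pairing_cubePoint] at *
    rw [abs_le] at this
    linarith [this.1]

open Classical in
/-- The vertex `v` as a point of the realization. -/
noncomputable def vertexReal (v : V) : V → ℝ := fun w => if v = w then 1 else 0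

theorem pairing_vertexReal (N : V → ℝ) (v : V) : pairing N (vertexReal v) = N v := by
  classical
  unfold pairing vertexReal
  rw [tsum_eq_single v]
  · simp
  · intro w hw
    simp [hw.symm]

theorem cubePoint_vertex {n : ℕ} (φ : (Fin n → Bool) → V) (x : Fin n → Bool) :
    cubePoint φ (fun i => if x i then 1 else 0) = vertexReal (φ x) := by
  classical
  funext v
  unfold cubePoint vertexReal
  rw [Finset.sum_eq_single x]
  · have : ∏ i, (if x i then (((if x i then 1 else 0 : unitInterval)) : ℝ) else
        1 - ((if x i then 1 else 0 : unitInterval) : ℝ)) = 1 := by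
      refine Finset.prod_eq_one fun i _ => ?_
      by_cases h : x i <;> simp [h]
    rw [this]
  · intro y _ hy
    obtain ⟨i, hi⟩ := Function.ne_iff.1 hy
    have : ∏ i, (if y i then (((if x i then 1 else 0 : unitInterval)) : ℝ) else
        1 - ((if x i then 1 else 0 : unitInterval) : ℝ)) = 0 := by
      refine Finset.prod_eq_zero (Finset.mem_univ i) ?_
      revert hi
      cases y i <;> cases x i <;> simp
    rw [this, ite_self]
  · simp

theorem vertexReal_mem (v : V) : vertexReal v ∈ X.realization := by
  obtain ⟨n, φ, hφ, h⟩ := X.exists_chart _ (X.singleton_mem v)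
  have hx : φ (fun _ => false) = v := by
    have : φ (fun _ => false) ∈ Set.range φ := ⟨_, rfl⟩
    rwa [h] at this
  exact ⟨n, φ, _, hφ, by rw [← hx, cubePoint_vertex]⟩

namespace StringLength

theorem trans {p q s : V → ℝ} {r r' : ℝ} (h : X.StringLength p q r)
    (h' : X.StringLength q s r') : X.StringLength p s (r + r') := by
  induction h with
  | nil => rwa [zero_add]
  | cons φ hφ a b _ ih =>
    rw [add_assoc]
    exact .cons φ hφ a b (ih h')

theorem single {n : ℕ} {φ : (Fin n → Bool) → V} (hφ : IsCubeChart X.cubes φ)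
    (s t : Fin n → unitInterval) :
    X.StringLength (cubePoint φ s) (cubePoint φ t) (∑ i, |(s i : ℝ) - (t i : ℝ)|) := by
  have := StringLength.cons φ hφ s t (.nil _ ⟨n, φ, t, hφ, rfl⟩)
  rwa [add_zero] at this

theorem symm {p q : V → ℝ} {r : ℝ} (h : X.StringLength p q r) : X.StringLength q p r := by
  induction h with
  | nil p hp => exact .nil p hp
  | cons φ hφ s t _ ih =>
    have := ih.trans (single hφ t s)
    rw [add_comm]
    simpa only [abs_sub_comm] using this

end StringLength

theorem isCubeChart_map (g : X.Aut) {n : ℕ} {φ : (Fin n → Bool) → V}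
    (hφ : IsCubeChart X.cubes φ) : IsCubeChart X.cubes (fun x => (g : Equiv.Perm V) (φ x)) := by
  refine ⟨(g : Equiv.Perm V).injective.comp hφ.1, fun d hd => ?_⟩
  have hd' : (g : Equiv.Perm V) '' ((g : Equiv.Perm V) ⁻¹' d) = d :=
    Set.image_preimage_eq _ (g : Equiv.Perm V).surjective
  have h1 := g.2 ((g : Equiv.Perm V) ⁻¹' d)
  rw [hd'] at h1
  rw [← h1, hφ.2]
  · refine exists_congr fun S => exists_congr fun a => ?_
    rw [Set.preimage_eq_iff_eq_image (g : Equiv.Perm V).bijective, Set.image_image]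
  · intro v hv
    obtain ⟨x, hx⟩ := hd hv
    exact ⟨x, (g : Equiv.Perm V).injective hx⟩

/-- The action of an automorphism on points of the realization. -/
def translate (g : X.Aut) (p : V → ℝ) : V → ℝ := fun v => p ((g : Equiv.Perm V)⁻¹ v)

theorem translate_mul (g h : X.Aut) (p : V → ℝ) :
    translate (g * h) p = translate g (translate h p) := by
  funext v
  simp [translate]

theorem translate_cubePoint (g : X.Aut) {n : ℕ} (φ : (Fin n → Bool) → V)
    (t : Fin n → unitInterval) :
    translate g (cubePoint φ t) = cubePoint (fun x => (g : Equiv.Perm V) (φ x)) t := by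
  funext v
  unfold translate cubePoint
  refine Finset.sum_congr rfl fun x _ => ?_
  congr 1
  rw [Equiv.Perm.eq_inv_iff_eq]

theorem translate_vertexReal (g : X.Aut) (v : V) :
    translate g (vertexReal v) = vertexReal ((g : Equiv.Perm V) v) := by
  funext w
  unfold translate vertexReal
  congr 1
  rw [Equiv.Perm.eq_inv_iff_eq]

theorem StringLength.map (g : X.Aut) {p q : V → ℝ} {r : ℝ} (h : X.StringLength p q r) :
    X.StringLength (translate g p) (translate g q) r := by
  induction h with
  | nil p hp =>
    obtain ⟨n, φ, t, hφ, rfl⟩ := hp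
    exact .nil _ ⟨n, _, t, isCubeChart_map g hφ, translate_cubePoint g φ t⟩
  | cons φ hφ s t _ ih =>
    rw [translate_cubePoint] at *
    exact .cons _ (isCubeChart_map g hφ) s t ih

theorem stringLength_adj {v w : V} (h : X.skeleton.Adj v w) :
    X.StringLength (vertexReal v) (vertexReal w) 1 := by
  obtain ⟨n, φ, hφ, hr⟩ := X.exists_chart _ h.2
  obtain ⟨x, rfl⟩ : v ∈ Set.range φ := by rw [hr]; simp
  obtain ⟨i, rfl⟩ := chart_neighbor hφ (by rw [hr]; simp) h
  have := StringLength.single hφ (fun k => if x k then 1 else 0)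
    (fun k => if flip x i k then 1 else 0)
  rw [cubePoint_vertex, cubePoint_vertex, Finset.sum_eq_single i] at this
  · convert this using 1
    by_cases hx : x i <;> simp [hx]
  · intro k _ hk
    rw [flip_of_ne _ hk, sub_self, abs_zero]
  · simp

theorem stringLength_walk {v w : V} (p : X.skeleton.Walk v w) :
    X.StringLength (vertexReal v) (vertexReal w) p.length := by
  induction p with
  | nil => simpa using StringLength.nil _ (vertexReal_mem _)
  | cons e p ih =>
    rw [SimpleGraph.Walk.length_cons, add_comm]
    push_cast
    exact (stringLength_adj e).trans ih

theorem exists_stringLength (hX : X.IsCAT0) (v : V) {p : V → ℝ} (hp : p ∈ X.realization) :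
    ∃ r, X.StringLength (vertexReal v) p r := by
  obtain ⟨n, φ, t, hφ, rfl⟩ := hp
  obtain ⟨q⟩ := hX.simplyConnected.1.preconnected v (φ fun _ => false)
  have h := StringLength.single hφ (fun _ => if (false : Bool) then 1 else 0) t
  rw [cubePoint_vertex φ fun _ => false] at h
  exact ⟨_, (stringLength_walk q).trans h⟩

theorem dist_le_of_stringLength (hX : X.IsCAT0) {u v : V} {r : ℝ}
    (h : X.StringLength (vertexReal u) (vertexReal v) r) : (X.skeleton.dist u v : ℝ) ≤ r := by
  have := h.pairing_le hX u
  simpa [pairing_vertexReal] using this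

theorem l1Dist_vertexReal (hX : X.IsCAT0) (u v : V) :
    X.l1Dist (vertexReal u) (vertexReal v) = X.skeleton.dist u v := by
  obtain ⟨p, hp⟩ := (hX.simplyConnected.1.preconnected u v).exists_walk_length_eq_dist
  refine IsLeast.csInf_eq ⟨?_, fun r hr => dist_le_of_stringLength hX hr⟩
  rw [← hp]
  exact stringLength_walk p

theorem StringLength.iterate {f : X.Aut} {p : V → ℝ} (hp : p ∈ X.realization) {r : ℝ}
    (h : X.StringLength p (translate f p) r) (k : ℕ) :
    X.StringLength p (translate (f ^ k) p) (k * r) := by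
  induction k with
  | zero =>
    have h1 : translate (f ^ 0) p = p := by
      funext v
      simp [translate]
    rw [h1, Nat.cast_zero, zero_mul]
    exact .nil p hp
  | succ k ih =>
    rw [pow_succ', translate_mul]
    push_cast
    rw [add_mul, one_mul, add_comm]
    exact h.trans (ih.map f)

/-- An automorphism with a vertex `p` on a combinatorial axis attains its translation length
at `p`, since its stable translation length is already that large. -/
theorem translationLength_eq (hX : X.IsCAT0) (f : X.Aut) (p : V)
    (h : ∀ k : ℕ, X.skeleton.dist p (((f ^ k : X.Aut) : Equiv.Perm V) p) =
      k * X.skeleton.dist p ((f : Equiv.Perm V) p)) :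
    X.translationLength f = X.skeleton.dist p ((f : Equiv.Perm V) p) := by
  refine IsLeast.csInf_eq ⟨⟨vertexReal p, vertexReal_mem p, ?_⟩, ?_⟩
  · rw [← l1Dist_vertexReal hX, ← translate_vertexReal]
    rfl
  · rintro _ ⟨x, hx, rfl⟩
    obtain ⟨R, hR⟩ := exists_stringLength hX p hx
    refine le_csInf ?_ fun r (hr : X.StringLength x (translate f x) r) => ?_
    · exact ⟨_, (hR.symm.trans (stringLength_walk
        (hX.simplyConnected.1.preconnected p ((f : Equiv.Perm V) p)).some)).trans
        (translate_vertexReal f p ▸ hR.map f)⟩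
    · by_contra! hlt
      obtain ⟨k, hk⟩ := exists_nat_gt
        (2 * R / ((X.skeleton.dist p ((f : Equiv.Perm V) p) : ℝ) - r))
      rw [div_lt_iff₀ (sub_pos.2 hlt)] at hk
      have h1 := (hR.trans (hr.iterate hx k)).trans (hR.symm.map (f ^ k))
      rw [translate_vertexReal] at h1
      have h2 := dist_le_of_stringLength hX h1
      rw [h k] at h2
      push_cast at h2
      linarith

/-! ### Intervals between points of the Roller compactification -/

/-- The vertex `p` lies in the interval between `x` and `y`. -/
def Between (p : V) (x y : X.Roller) : Prop := ∀ j, j ∈ x.sides → j ∈ y.sides → p ∈ j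

/-- The halfspaces that contain `x` and `y` but not `v`. -/
def gromovSet (v : V) (x y : X.Roller) : Set (Set V) := {h | h ∈ x.sides ∧ h ∈ y.sides ∧ v ∉ h}

theorem gromovProduct_eq_coe {v : V} {x y : X.Roller} (h : (gromovSet v x y).Finite) :
    X.gromovProduct v x y = ((gromovSet v x y).ncard : ℕ∞) :=
  (Set.Finite.cast_ncard_eq h).symm

/-- A halfspace containing both `x` and `y` and at minimal distance from `p` is adjacent to `p`. -/
theorem exists_adj_side_mem (hX : X.IsCAT0) (x y : X.Roller) {p : V} (n : ℕ) {j : Set V} {u : V}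
    (hj : j ∈ gromovSet p x y) (hu : u ∈ j) (hn : X.skeleton.dist p u = n) :
    ∃ q, X.skeleton.Adj p q ∧ X.side q p ∈ x.sides ∧ X.side q p ∈ y.sides := by
  induction n using Nat.strong_induction_on generalizing j u with
  | _ n IH =>
  obtain ⟨hjx, hjy, hpj⟩ := hj
  have hjh := x.isHalfspace j hjx
  rcases n with _ | n
  · obtain rfl := (hX.simplyConnected.1.preconnected p u).dist_eq_zero_iff.1 hn
    exact absurd hu hpj
  rw [SimpleGraph.dist_comm] at hn
  obtain ⟨b, hub, hb⟩ := exists_adj_closer hX hn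
  rw [SimpleGraph.dist_comm] at hn hb
  by_cases hbj : b ∈ j
  · exact IH n (by omega) ⟨hjx, hjy, hpj⟩ hbj hb
  have hjs := hjh.eq_side hX hub hu hbj
  -- `b` precedes `u` on a geodesic from `p`, so `j` is the side of the last edge `b u`
  rcases n with _ | n
  · obtain rfl := (hX.simplyConnected.1.preconnected p b).dist_eq_zero_iff.1 hb
    exact ⟨u, hub.symm, hjs ▸ hjx, hjs ▸ hjy⟩
  rw [SimpleGraph.dist_comm] at hb
  obtain ⟨c, hbc, hc⟩ := exists_adj_closer hX hb
  rw [SimpleGraph.dist_comm] at hb hc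
  have hk := isHalfspace_side hX hbc
  have hpk : p ∉ X.side b c := by rw [mem_side]; omega
  by_cases hkxy : X.side b c ∈ x.sides ∧ X.side b c ∈ y.sides
  · exact IH (n + 1) (by omega) ⟨hkxy.1, hkxy.2, hpk⟩ (left_mem_side hbc) hb
  -- the hyperplanes of the last two edges cross, so these edges span a square, and the vertex of it
  -- opposite to `b` is a vertex of `j` closer to `p`
  have hz : ∃ z, z ∈ j ∧ z ∈ (X.side b c)ᶜ := by
    rcases not_and_or.1 hkxy with h | h
    · exact x.inter_nonempty _ hjx _ ((x.compl_mem_iff hX hk).2 h)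
    · exact y.inter_nonempty _ hjy _ ((y.compl_mem_iff hX hk).2 h)
  obtain ⟨z, hzj, hzk⟩ := hz
  rw [hjs, mem_side] at hzj
  rw [side_compl hX hbc, mem_side] at hzk
  have h1 := dist_adj hX z hub
  have h2 := dist_adj hX z hbc
  obtain ⟨w, s, -⟩ := quadrangle hX (o := z) hub.symm hbc
    (by rintro rfl; omega) (by omega) (by omega)
  have hw : w ∈ j := by
    rw [hjs, side_eq_of_isSquare hX s.rotate.reflect]
    exact left_mem_side s.cd
  have h3 := dist_adj hX p s.cd
  exact IH (X.skeleton.dist p w) (by omega) ⟨hjx, hjy, hpj⟩ hw rfl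

/-- Move a vertex across hyperplanes having `x` and `y` on the other side until none are left. -/
theorem exists_between (hX : X.IsCAT0) {x y : X.Roller}
    (hfin : ∀ v, (gromovSet v x y).Finite) : ∃ p, Between p x y := by
  obtain ⟨v⟩ := hX.simplyConnected.1.nonempty
  induction hn : (gromovSet v x y).ncard using Nat.strong_induction_on generalizing v with
  | _ n IH =>
  by_cases h0 : gromovSet v x y = ∅
  · refine ⟨v, fun j hx hy => ?_⟩
    by_contra hv
    exact Set.eq_empty_iff_forall_notMem.1 h0 j ⟨hx, hy, hv⟩
  obtain ⟨j, hj⟩ := Set.nonempty_iff_ne_empty.2 h0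
  obtain ⟨u, hu⟩ := (x.isHalfspace j hj.1).nonempty
  obtain ⟨q, hvq, hqx, hqy⟩ := exists_adj_side_mem hX x y _ hj hu rfl
  refine IH _ ?_ q rfl
  rw [← hn]
  refine Set.ncard_lt_ncard ⟨?_, fun hle => ?_⟩ (hfin v)
  · rintro k ⟨hkx, hky, hqk⟩
    refine ⟨hkx, hky, fun hvk => ?_⟩
    have hk := (x.isHalfspace k hkx).eq_side hX hvq hvk hqk
    rw [← side_compl hX hvq, ← hk] at hqx
    exact (x.compl_mem_iff hX (x.isHalfspace k hkx)).1 hqx hkx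
  · exact (hle ⟨hqx, hqy, right_notMem_side⟩).2.2 (left_mem_side hvq.symm)

/-- The halfspaces that contain `x` and `p` but not `v`; their number is the Gromov product
`(x · p)_v`. -/
def vertexGromovSet (x : X.Roller) (p v : V) : Set (Set V) := {j | j ∈ X.sep p v ∧ j ∈ x.sides}

theorem vertexGromovSet_finite (hX : X.IsCAT0) (x : X.Roller) (p v : V) :
    (vertexGromovSet x p v).Finite := (sep_finite hX p v).subset fun _ h => h.1

/-- A point `z` on the same sides as `x` of the hyperplanes separating `p` from `v` has the same
Gromov product with `p` as `x`. -/
theorem dist_add_two_mul (hX : X.IsCAT0) (x : X.Roller) {p v z : V}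
    (h : ∀ j ∈ X.sep p v, (z ∈ j ↔ j ∈ x.sides)) :
    X.skeleton.dist p z + 2 * (vertexGromovSet x p v).ncard =
      X.skeleton.dist p v + X.skeleton.dist v z := by
  have e0 : vertexGromovSet x p v = {j ∈ X.sep p v | z ∈ j} :=
    Set.ext fun j => and_congr_right fun hj => (h j hj).symm
  rw [e0]
  have e1 : X.sep p v = {j ∈ X.sep p v | z ∈ j} ∪ {j ∈ X.sep p v | z ∉ j} := by
    ext j
    simp only [Set.mem_union, Set.mem_sep_iff]
    tauto
  have e2 : X.sep p z = {j ∈ X.sep p v | z ∉ j} ∪ {j ∈ X.sep p z | v ∈ j} := by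
    ext j
    simp only [Set.mem_union, sep, Set.mem_ofPred_eq]
    tauto
  have e3 : X.sep v z = (fun j => jᶜ) '' {j ∈ X.sep p v | z ∈ j} ∪ {j ∈ X.sep p z | v ∈ j} := by
    ext j
    simp only [Set.mem_union, sep, Set.mem_ofPred_eq, Set.mem_image]
    constructor
    · rintro ⟨hj, hv, hz⟩
      by_cases hp : p ∈ j
      · exact .inr ⟨⟨hj, hp, hz⟩, hv⟩
      · exact .inl ⟨jᶜ, ⟨⟨hj.compl hX, hp, fun h => h hv⟩, hz⟩, compl_compl j⟩
    · rintro (⟨k, ⟨⟨hk, hp, hv⟩, hz⟩, rfl⟩ | ⟨⟨hj, hp, hz⟩, hv⟩)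
      · exact ⟨hk.compl hX, hv, fun h => h hz⟩
      · exact ⟨hj, hv, hz⟩
  have f1 := (sep_finite hX p v).subset (Set.sep_subset _ fun j => z ∈ j)
  have f2 := (sep_finite hX p v).subset (Set.sep_subset _ fun j => z ∉ j)
  have f3 := (sep_finite hX p z).subset (Set.sep_subset _ fun j => v ∈ j)
  have n1 := congrArg Set.ncard e1
  have n2 := congrArg Set.ncard e2
  have n3 := congrArg Set.ncard e3
  rw [Set.ncard_union_eq _ f1 f2, ncard_sep hX] at n1
  · rw [Set.ncard_union_eq _ f2 f3, ncard_sep hX] at n2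
    · rw [Set.ncard_union_eq _ (f1.image _) f3, Set.ncard_image_of_injective _ compl_injective,
        ncard_sep hX] at n3
      · omega
      · rw [Set.disjoint_left]
        rintro _ ⟨k, ⟨hk, hz⟩, rfl⟩ h2
        exact h2.1.2.1 hk.2.1
    · rw [Set.disjoint_left]
      exact fun j h1 h2 => h1.1.2.2 h2.2
  · rw [Set.disjoint_left]
    exact fun j h1 h2 => h2.2 h1.2

/-- Each halfspace containing `p` but not `v` contains `x` or `y`, and those containing both are
counted by the Gromov product. -/
theorem Between.dist_add (hX : X.IsCAT0) {x y : X.Roller} {p : V} (hp : Between p x y) (v : V) :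
    X.skeleton.dist p v + (gromovSet v x y).ncard =
      (vertexGromovSet x p v).ncard + (vertexGromovSet y p v).ncard := by
  rw [← Set.ncard_union_add_ncard_inter _ _ (vertexGromovSet_finite hX x p v)
    (vertexGromovSet_finite hX y p v), ← ncard_sep hX]
  congr 2
  · ext j
    constructor
    · intro hj
      by_contra hn
      have hx : j ∉ x.sides := fun h => hn (.inl ⟨hj, h⟩)
      have hy : j ∉ y.sides := fun h => hn (.inr ⟨hj, h⟩)
      exact hp _ ((x.compl_mem_iff hX hj.1).2 hx) ((y.compl_mem_iff hX hj.1).2 hy) hj.2.1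
    · rintro (h | h) <;> exact h.1
  · ext j
    constructor
    · rintro ⟨hx, hy, hv⟩
      have hj : j ∈ X.sep p v := ⟨x.isHalfspace j hx, hp j hx hy, hv⟩
      exact ⟨⟨hj, hx⟩, hj, hy⟩
    · rintro ⟨⟨hj, hx⟩, -, hy⟩
      exact ⟨hx, hy, hj.2.2⟩

namespace Axis

variable {g h : X.Aut} {a b : ℤ → Set V}

/-- A halfspace containing the pole and `x`, but not a vertex `v` outside `a m`, contains all of
`a (m + 1)` once `x` lies outside `a m`, and so separates `v` from any fixed vertex of
`a (m + 1)`. -/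
theorem gromovSet_finite (hX : X.IsCAT0) (A : X.Axis g a) {x : X.Roller} (hx : x ≠ A.pole hX)
    (v : V) : (gromovSet v x (A.pole hX)).Finite := by
  obtain ⟨m, hm⟩ := (A.eq_pole_or_exists hX x).resolve_left hx
  obtain ⟨N, hN⟩ := A.exists_forall_notMem hX v
  obtain ⟨u, hu⟩ := (A.isHalfspace (max m N + 1)).nonempty
  refine (sep_finite hX u v).subset ?_
  rintro j ⟨hjx, hjp, hv⟩
  have hj := x.isHalfspace j hjx
  refine ⟨hj, ?_, hv⟩
  by_contra hu'
  have hm' : (a (max m N))ᶜ ∈ x.sides := x.mem_of_subset hX hm ((A.isHalfspace _).compl hX)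
    (Set.compl_subset_compl.2 (A.anti (le_max_left _ _)))
  exact A.deep (max m N) j hj ((A.pole hX).inter_nonempty _ hjp _ (A.mem_pole hX _))
    ⟨u, hu', hu⟩ (x.inter_nonempty _ hjx _ hm') ⟨v, hv, hN _ (le_max_right _ _)⟩

/-- Convergence of the orbit of a vertex to the pole. -/
theorem eventually_pow_mem_iff (hX : X.IsCAT0) (A : X.Axis g a) (q : V) {j : Set V}
    (hj : X.IsHalfspace j) :
    ∀ᶠ n : ℕ in atTop, (((g ^ n : X.Aut) : Equiv.Perm V) q ∈ j ↔ j ∈ (A.pole hX).sides) := by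
  obtain ⟨m, hm⟩ := A.exists_forall_mem hX q
  filter_upwards [A.eventually_mem_iff hX (x := X.vertexPoint q) (m := m)
    ⟨A.isHalfspace m, hm m le_rfl⟩ j] with n hn
  rw [← hn, Roller.mem_rollerMap]
  exact ⟨fun h => ⟨hj.preimage _, h⟩, fun h => h.2⟩

theorem eventually_dist (hX : X.IsCAT0) (A : X.Axis g a) (p q v : V) :
    ∀ᶠ n : ℕ in atTop, X.skeleton.dist p (((g ^ n : X.Aut) : Equiv.Perm V) q) +
        2 * (vertexGromovSet (A.pole hX) p v).ncard =
      X.skeleton.dist p v + X.skeleton.dist v (((g ^ n : X.Aut) : Equiv.Perm V) q) := by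
  have := (eventually_all_finite (sep_finite hX p v)).2
    fun j hj => A.eventually_pow_mem_iff hX q hj.1
  filter_upwards [this] with n hn
  exact dist_add_two_mul hX _ hn

/-- The distance from `p` to `gⁿ q` differs from that from `v` to `gⁿ v` by a constant, which is
expressed by Gromov products with the poles. -/
theorem eventually_dist_pow (hX : X.IsCAT0) (A : X.Axis g a) (p q v : V) :
    ∀ᶠ n : ℕ in atTop, X.skeleton.dist p (((g ^ n : X.Aut) : Equiv.Perm V) q) +
        2 * (vertexGromovSet (A.pole hX) p v).ncard +
        2 * (vertexGromovSet ((A.inv hX).pole hX) q v).ncard =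
      X.skeleton.dist p v + X.skeleton.dist q v +
        X.skeleton.dist v (((g ^ n : X.Aut) : Equiv.Perm V) v) := by
  filter_upwards [A.eventually_dist hX p q v, (A.inv hX).eventually_dist hX q v v] with n h1 h2
  rw [dist_inv_pow hX, dist_inv_pow hX] at h2
  omega

theorem eventually_disjoint (hX : X.IsCAT0) (A : X.Axis g a) (B : X.Axis h b)
    (hne : A.pole hX ≠ B.pole hX) : ∃ M : ℤ, ∀ m ≥ M, Disjoint (a m) (b m) := by
  obtain ⟨j, ⟨-, m, hm⟩, -, n, hn⟩ := Roller.exists_mem_compl_mem hX hne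
  refine ⟨max m n, fun k hk => Set.disjoint_left.2 fun v h1 h2 => ?_⟩
  exact hn (B.anti ((le_max_right _ _).trans hk) h2) (hm (A.anti ((le_max_left _ _).trans hk) h1))

/-- A vertex of the interval between two poles lies on a geodesic between any two vertices that
are separated from it by enough halfspaces of the two axes: a halfspace containing it but not the
other two would cut two strongly separated halfspaces of one of the axes. -/
theorem dist_eq_add_of_between (hX : X.IsCAT0) (A : X.Axis g a) (B : X.Axis h b) {p u w : V}
    (hp : Between p (B.pole hX) (A.pole hX)) {M K : ℤ} (hMK : M < K)
    (hdisj : Disjoint (a M) (b M)) (hpa : p ∉ a M) (hpb : p ∉ b M) (hu : u ∈ a K) (hw : w ∈ b K) :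
    X.skeleton.dist w u = X.skeleton.dist w p + X.skeleton.dist p u := by
  refine dist_eq_add hX fun j hj hpj hwj => ?_
  by_contra huj
  have hu' : u ∉ b M := Set.disjoint_left.1 hdisj (A.anti hMK.le hu)
  have hw' : w ∉ a M := Set.disjoint_right.1 hdisj (B.anti hMK.le hw)
  have hor : j ∈ (B.pole hX).sides ∨ j ∈ (A.pole hX).sides := by
    by_contra! hn
    exact hp _ ((Roller.compl_mem_iff hX _ hj).2 hn.1) ((Roller.compl_mem_iff hX _ hj).2 hn.2) hpj
  rcases hor with hor | hor
  · exact B.deep_of_lt hMK hj (Roller.inter_nonempty _ _ hor _ (B.mem_pole hX K)) ⟨w, hwj, hw⟩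
      ⟨p, hpj, hpb⟩ ⟨u, huj, hu'⟩
  · exact A.deep_of_lt hMK hj (Roller.inter_nonempty _ _ hor _ (A.mem_pole hX K)) ⟨u, huj, hu⟩
      ⟨p, hpj, hpa⟩ ⟨w, hwj, hw'⟩

end Axis

/-! ### Translation lengths of large powers and their products -/

/-- It suffices that `p` lies on a geodesic from `f⁻ᵏ p` to `f p` for each `k ≥ 1`. -/
theorem translationLength_eq_of_local (hX : X.IsCAT0) (f : X.Aut) (p : V)
    (h : ∀ k : ℕ, 1 ≤ k → X.skeleton.dist (((f⁻¹ ^ k : X.Aut) : Equiv.Perm V) p)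
        ((f : Equiv.Perm V) p) =
      X.skeleton.dist (((f⁻¹ ^ k : X.Aut) : Equiv.Perm V) p) p +
        X.skeleton.dist p ((f : Equiv.Perm V) p)) :
    X.translationLength f = X.skeleton.dist p ((f : Equiv.Perm V) p) := by
  refine translationLength_eq hX f p fun k => ?_
  induction k with
  | zero => simp
  | succ k ih =>
    rcases Nat.eq_zero_or_pos k with rfl | hk
    · simp
    have h1 := h k hk
    rw [X.skeleton.dist_comm (v := p), dist_inv_pow hX, ih] at h1
    rw [add_mul, one_mul, ← h1, ← dist_map hX (f ^ k) (((f⁻¹ ^ k : X.Aut) : Equiv.Perm V) p)]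
    congr 1
    rw [inv_pow, ← Equiv.Perm.mul_apply, ← Subgroup.coe_mul, mul_inv_cancel]
    rfl

namespace Axis

variable {g h : X.Aut} {a b : ℤ → Set V}

theorem eventually_translationLength_pow (hX : X.IsCAT0) (A : X.Axis g a) {p : V}
    (hp : Between p ((A.inv hX).pole hX) (A.pole hX)) :
    ∀ᶠ n : ℕ in atTop, X.translationLength (g ^ n) =
      X.skeleton.dist p (((g ^ n : X.Aut) : Equiv.Perm V) p) := by
  obtain ⟨M₁, hM₁⟩ := A.exists_forall_notMem hX p
  obtain ⟨M₂, hM₂⟩ := (A.inv hX).exists_forall_notMem hX p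
  obtain ⟨M₃, hM₃⟩ := A.eventually_disjoint hX (A.inv hX) (A.pole_ne hX).symm
  obtain ⟨M, h1, h2, h3⟩ : ∃ M : ℕ, M₁ ≤ M ∧ M₂ ≤ M ∧ M₃ ≤ M :=
    ⟨(max M₁ (max M₂ M₃)).toNat, by omega, by omega, by omega⟩
  have hpa := hM₁ M h1
  have hpa' := hM₂ M h2
  filter_upwards [eventually_ge_atTop (2 * M + 1)] with n hn
  refine translationLength_eq_of_local hX _ p fun k hk => ?_
  refine A.dist_eq_add_of_between hX (A.inv hX) hp (M := M) (K := n - M) (by omega)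
    (hM₃ M h3) hpa hpa' ?_ ?_
  · rw [A.pow_mem]
    rw [Set.notMem_compl_iff] at hpa'
    convert hpa' using 2
    ring
  · rw [← inv_pow, ← pow_mul, (A.inv hX).pow_mem]
    refine (A.inv hX).anti (k := -M) ?_ ?_
    · have : n ≤ n * k := Nat.le_mul_of_pos_right n hk
      omega
    · simpa using hpa

/-- The orbit of `p` under `gⁿ hⁿ`, interspersed with that of `gⁿ q`, lies on a geodesic for large
`n`. -/
theorem eventually_translationLength_mul (hX : X.IsCAT0) (A : X.Axis g a) (B : X.Axis h b)
    (h₁ : (B.inv hX).pole hX ≠ A.pole hX) (h₂ : (A.inv hX).pole hX ≠ B.pole hX) {p q : V}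
    (hp : Between p ((B.inv hX).pole hX) (A.pole hX))
    (hq : Between q ((A.inv hX).pole hX) (B.pole hX)) :
    ∀ᶠ n : ℕ in atTop, X.translationLength (g ^ n * h ^ n) =
      ((X.skeleton.dist p (((g ^ n : X.Aut) : Equiv.Perm V) q) +
        X.skeleton.dist q (((h ^ n : X.Aut) : Equiv.Perm V) p) : ℕ) : ℝ) := by
  obtain ⟨M₁, hM₁⟩ := A.exists_forall_notMem hX p
  obtain ⟨M₂, hM₂⟩ := (B.inv hX).exists_forall_notMem hX p
  obtain ⟨M₃, hM₃⟩ := B.exists_forall_notMem hX q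
  obtain ⟨M₄, hM₄⟩ := (A.inv hX).exists_forall_notMem hX q
  obtain ⟨M₅, hM₅⟩ := A.eventually_disjoint hX (B.inv hX) h₁.symm
  obtain ⟨M₆, hM₆⟩ := B.eventually_disjoint hX (A.inv hX) h₂.symm
  obtain ⟨M, l1, l2, l3, l4, l5, l6⟩ :
      ∃ M : ℕ, M₁ ≤ M ∧ M₂ ≤ M ∧ M₃ ≤ M ∧ M₄ ≤ M ∧ M₅ ≤ M ∧ M₆ ≤ M :=
    ⟨(max M₁ (max M₂ (max M₃ (max M₄ (max M₅ M₆))))).toNat, by omega, by omega, by omega,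
      by omega, by omega, by omega⟩
  have hpa := hM₁ M l1
  have hpb := hM₂ M l2
  have hab := hM₅ M l5
  have hba := hM₆ M l6
  filter_upwards [eventually_ge_atTop (2 * M + 1)] with n hn
  have hlt : (M : ℤ) < n - M := by omega
  -- where `hⁿ` and `g⁻ⁿ` map the points outside the repelling halfspaces
  have hB : ((h ^ n : X.Aut) : Equiv.Perm V) p ∈ b (n - M) := by
    rw [B.pow_mem]
    rw [Set.notMem_compl_iff] at hpb
    convert hpb using 2
    ring
  have hA : ∀ x, x ∉ a M → ((g⁻¹ ^ n : X.Aut) : Equiv.Perm V) x ∈ (a (-((n : ℤ) - M)))ᶜ := by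
    intro x hx
    rw [(A.inv hX).pow_mem n ((n : ℤ) - M)]
    simpa using hx
  have hback : ∀ x, x ∉ a M → (((g ^ n * h ^ n)⁻¹ : X.Aut) : Equiv.Perm V) x ∈
      (b (-((n : ℤ) - M)))ᶜ := by
    intro x hx
    have e : (((g ^ n * h ^ n)⁻¹ : X.Aut) : Equiv.Perm V) x =
        ((h⁻¹ ^ n : X.Aut) : Equiv.Perm V) (((g⁻¹ ^ n : X.Aut) : Equiv.Perm V) x) := by
      rw [mul_inv_rev, inv_pow, inv_pow]
      rfl
    rw [e, (B.inv hX).pow_mem n ((n : ℤ) - M)]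
    have := Set.disjoint_right.1 hba ((A.inv hX).anti hlt.le (hA x hx))
    simpa using this
  have hiter : ∀ k : ℕ, 1 ≤ k → (((g ^ n * h ^ n)⁻¹ ^ k : X.Aut) : Equiv.Perm V) p ∈
      (b (-((n : ℤ) - M)))ᶜ := by
    intro k hk
    induction k, hk using Nat.le_induction with
    | base => rw [pow_one]; exact hback p hpa
    | succ k _ ih =>
      rw [pow_succ']
      exact hback _ (Set.disjoint_right.1 hab ((B.inv hX).anti hlt.le ih))
  rw [translationLength_eq_of_local hX _ p fun k hk => ?_]
  · have hmid := B.dist_eq_add_of_between hX (A.inv hX) hq hlt hba (hM₃ M l3) (hM₄ M l4) hB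
      (hA p hpa)
    rw [X.skeleton.dist_comm (v := q), dist_inv_pow hX] at hmid
    rw [← hmid, ← dist_map hX (g ^ n) (((g⁻¹ ^ n : X.Aut) : Equiv.Perm V) p)]
    congr 2
    rw [inv_pow, ← Equiv.Perm.mul_apply, ← Subgroup.coe_mul, mul_inv_cancel]
    rfl
  · refine A.dist_eq_add_of_between hX (B.inv hX) hp hlt hab hpa hpb ?_ (hiter k hk)
    rw [Subgroup.coe_mul, Equiv.Perm.mul_apply, A.pow_mem]
    have := Set.disjoint_left.1 hba (B.anti hlt.le hB)
    rw [Set.notMem_compl_iff] at this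
    convert this using 2
    ring

/-- Comparison of translation lengths with Gromov products based at `v`. -/
theorem eventually_translationLength_formula (hX : X.IsCAT0) (A : X.Axis g a) (B : X.Axis h b)
    (h₁ : (B.inv hX).pole hX ≠ A.pole hX) (h₂ : (A.inv hX).pole hX ≠ B.pole hX) (v : V) :
    ∀ᶠ n : ℕ in atTop, X.translationLength (g ^ n * h ^ n) - X.translationLength (g ^ n) -
        X.translationLength (h ^ n) =
      2 * ((((gromovSet v ((A.inv hX).pole hX) (A.pole hX)).ncard +
          (gromovSet v ((B.inv hX).pole hX) (B.pole hX)).ncard : ℕ) : ℝ) -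
        (((gromovSet v ((A.inv hX).pole hX) (B.pole hX)).ncard +
          (gromovSet v ((B.inv hX).pole hX) (A.pole hX)).ncard : ℕ) : ℝ)) := by
  -- `c` and `d` lie on the axes of `g` and `h`, while `p` and (up to `gⁿ`) `q` lie where an axis
  -- of `gⁿ hⁿ` passes from the direction of one automorphism to that of the other
  obtain ⟨c, hc⟩ := exists_between hX (A.gromovSet_finite hX (A.pole_ne hX))
  obtain ⟨d, hd⟩ := exists_between hX (B.gromovSet_finite hX (B.pole_ne hX))
  obtain ⟨p, hp⟩ := exists_between hX (A.gromovSet_finite hX h₁)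
  obtain ⟨q, hq⟩ := exists_between hX (B.gromovSet_finite hX h₂)
  have c1 := hc.dist_add hX v
  have d1 := hd.dist_add hX v
  have p1 := hp.dist_add hX v
  have q1 := hq.dist_add hX v
  filter_upwards [A.eventually_translationLength_pow hX hc,
    B.eventually_translationLength_pow hX hd,
    A.eventually_translationLength_mul hX B h₁ h₂ hp hq, A.eventually_dist_pow hX c c v,
    B.eventually_dist_pow hX d d v, A.eventually_dist_pow hX p q v,
    B.eventually_dist_pow hX q p v] with n e1 e2 e3 e4 e5 e6 e7
  rw [e1, e2, e3, sub_eq_iff_eq_add, sub_eq_iff_eq_add, mul_sub, ← sub_eq_zero]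
  rify at *
  linarith

end Axis

end CubeComplex

theorem mainTheorem10 {V : Type u} (X : CubeComplex V) (hX : X.IsCAT0) (hirr : X.Irreducible)
    (hfin : X.LocallyFinite) (g h : X.Aut)
    (hg : X.NeatlyContracting g) (hh : X.NeatlyContracting h) :
    (∃! q : X.Roller × X.Roller, X.IsPolePair g q.1 q.2) ∧
    (∃! q : X.Roller × X.Roller, X.IsPolePair h q.1 q.2) ∧
    ∀ gm gp hm hp : X.Roller, X.IsPolePair g gm gp → X.IsPolePair h hm hp →
      [gm, gp, hm, hp].Nodup →
      (∀ v : V, X.InCrossRatioDomain v gm hm gp hp) ∧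
      ∃ N : ℕ, ∀ n : ℕ, N ≤ n → ∀ v : V,
        2 * X.crossRatio v gm hm gp hp =
          ((X.translationLength (g ^ n * h ^ n) - X.translationLength (g ^ n)
            - X.translationLength (h ^ n) : ℝ) : EReal) := by
  obtain ⟨a, A⟩ := hg.exists_axis
  obtain ⟨b, B⟩ := hh.exists_axis
  refine ⟨A.existsUnique_isPolePair hX, B.existsUnique_isPolePair hX, ?_⟩
  intro gm gp hm hp hgp hhp hnodup
  obtain ⟨rfl, rfl⟩ := (A.isPolePair_iff hX).1 hgp
  obtain ⟨rfl, rfl⟩ := (B.isPolePair_iff hX).1 hhp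
  have h₁ : (B.inv hX).pole hX ≠ A.pole hX := by
    rintro e; simp [e] at hnodup
  have h₂ : (A.inv hX).pole hX ≠ B.pole hX := by
    rintro e; simp [e] at hnodup
  have hprod := fun v =>
    CubeComplex.gromovProduct_eq_coe (A.gromovSet_finite hX (A.pole_ne hX) v)
  have hprod₂ := fun v =>
    CubeComplex.gromovProduct_eq_coe (B.gromovSet_finite hX (B.pole_ne hX) v)
  have hprod₃ := fun v =>
    CubeComplex.gromovProduct_eq_coe (A.gromovSet_finite hX h₁ v)
  have hprod₄ := fun v =>
    CubeComplex.gromovProduct_eq_coe (B.gromovSet_finite hX h₂ v)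
  refine ⟨fun v => .inr (.inr ⟨?_, ?_⟩), ?_⟩
  · rw [hprod, hprod₂]
    exact ENat.natCast_ne_top _
  · rw [hprod₃, hprod₄]
    exact ENat.natCast_ne_top _
  have key : ∀ v, ∀ᶠ n : ℕ in atTop,
      2 * X.crossRatio v ((A.inv hX).pole hX) ((B.inv hX).pole hX) (A.pole hX) (B.pole hX) =
        ((X.translationLength (g ^ n * h ^ n) - X.translationLength (g ^ n)
          - X.translationLength (h ^ n) : ℝ) : EReal) := by
    intro v
    filter_upwards [A.eventually_translationLength_formula hX B h₁ h₂ v] with n hn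
    rw [hn, CubeComplex.crossRatio, hprod, hprod₂, hprod₃, hprod₄, ← Nat.cast_add, ← Nat.cast_add]
    simp
    rfl
  obtain ⟨v₀⟩ := hX.simplyConnected.1.nonempty
  obtain ⟨N, hN⟩ := eventually_atTop.1 (key v₀)
  refine ⟨N, fun n hn v => ?_⟩
  -- the formula at `v` and `v₀` for one common exponent shows that the cross ratio
  -- does not depend on the base point
  obtain ⟨k, hk, hk₀⟩ := ((key v).and (key v₀)).exists
  rw [hk, ← hk₀, hN n hn]
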